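/- An *ordered graph* is a finite simple graph whose vertex set carries a total order; ordered graphs are considered up to order-preserving isomorphism. A class $\mathscr C$ of ordered graphs is *hereditary* if it is closed under induced ordered subgraphs, and its *growth* is the function sending $n$ to the number $|\mathscr C_n|$ of $n$-vertex ordered graphs in $\mathscr C$, up to isomorphism. The growth is $2^{O(n)}$ if there is $K$ with $|\mathscr C_n|\le 2^{Kn}$ for all large $n$, and it is $2^{\omega(n)}$ if for every $K$ we have $|\mathscr C_n|\ge 2^{Kn}$ for all large $n$. For a permutation $\pi$ of $[n]=\{1,\dots,n\}$, the *ordered permutation graph* of $\pi$ has vertices $1<\dots<n$, with $i<j$ adjacent if and only if $\pi(i)>\pi(j)$. Let $\mathscr P$ be the class of all ordered permutation graphs. For $s\in\{=,\neq,\le_l,\ge_l,\le_r,\ge_r\}$, $\lambda,\rho\in\{0,1\}$ and a permutation $\sigma$ of $[n]$, let $G_{s,\lambda,\rho}(\sigma)$ be the ordered graph with vertices $a_1<\dots<a_n<b_1<\dots<b_n$ in which the $a_i$ form a clique if $\lambda=1$ and an independent set if $\lambda=0$, the $b_j$ form a clique if $\rho=1$ and an independent set if $\rho=0$, and $a_i$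 is adjacent to $b_j$ if and only if, respectively, $\sigma(i)=j$, $\ \sigma(i)\ne j$, $\ i\le\sigma^{-1}(j)$, $\ i\ge\sigma^{-1}(j)$, $\ j\le\sigma(i)$, $\ j\ge\sigma(i)$. Let $\mathscr M_{s,\lambda,\rho}$ be the class of all induced ordered subgraphs of the graphs $G_{s,\lambda,\rho}(\sigma)$, over all $n$ and all permutations $\sigma$ of $[n]$. **Corollary.** A class $\mathscr C$ of ordered graphs is hereditary, has growth $2^{\omega(n)}$, and has the property that every proper hereditary subclass of $\mathscr C$ has growth $2^{O(n)}$, if and only if $\mathscr C$ is one of the classes $\mathscr P$ and $\mathscr M_{s,\lambda,\rho}$ with $s\in\{=,\neq,\le_l,\ge_l,\le_r,\ge_r\}$ and $\lambda,\rho\in\{0,1\}$. Moreover, none of these classes, indexed by $\mathscr P$ and the 24 triples $(s,\lambda,\rho)$, is included in another one; in particular they are exactly 25 distinct classes. -/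

import Mathlib

/-- A class of finite ordered graphs. A finite linear order with `n` elements is isomorphic to
`Fin n` by a unique order isomorphism, so isomorphism types of ordered graphs on `n` vertices are
the same thing as graphs on `Fin n`. A class of ordered graphs (closed under isomorphism) is thus
given by, for every `n`, its set of graphs with vertex set `Fin n`. Inclusion of classes is the
pointwise order `≤`, and `D < C` means that `D` is a proper subclass of `C`. -/
abbrev OrderedGraphClass : Type := (n : ℕ) → Set (SimpleGraph (Fin n))

namespace OrderedGraphClass

/-- Closed under induced ordered subgraphs: an induced ordered subgraph on `m` vertices of a graph
on `Fin n` is, up to isomorphism, the pullback along an order embedding `Fin m ↪o Fin n`. -/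
def IsHereditary (C : OrderedGraphClass) : Prop :=
  ∀ ⦃m n : ℕ⦄ (f : Fin m ↪o Fin n) (G : SimpleGraph (Fin n)), G ∈ C n → G.comap f ∈ C m

/-- The number of `n`-vertex ordered graphs in the class, up to isomorphism. -/
noncomputable def growth (C : OrderedGraphClass) (n : ℕ) : ℕ := (C n).ncard

/-- Growth `2 ^ O(n)`. -/
def HasExpGrowth (C : OrderedGraphClass) : Prop :=
  ∃ K : ℕ, ∀ᶠ n in Filter.atTop, C.growth n ≤ 2 ^ (K * n)

/-- Growth `2 ^ ω(n)`. -/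
def HasSuperexpGrowth (C : OrderedGraphClass) : Prop :=
  ∀ K : ℕ, ∀ᶠ n in Filter.atTop, 2 ^ (K * n) ≤ C.growth n

/-- Hereditary classes with growth `2 ^ ω(n)` all of whose proper hereditary subclasses have
growth `2 ^ O(n)`. -/
def IsStanleyWilf (C : OrderedGraphClass) : Prop :=
  C.IsHereditary ∧ C.HasSuperexpGrowth ∧
    ∀ D : OrderedGraphClass, D.IsHereditary → D < C → D.HasExpGrowth

/-- The ordered permutation graph of `π`: vertices `i < j` are adjacent iff `π j < π i`. -/
def permGraph {n : ℕ} (π : Equiv.Perm (Fin n)) : SimpleGraph (Fin n) where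
  Adj i j := (i < j ∧ π j < π i) ∨ (j < i ∧ π i < π j)
  symm := ⟨fun _ _ h => h.symm⟩
  loopless := ⟨fun i h => by simp at h⟩

/-- The class of all ordered permutation graphs. -/
def permClass : OrderedGraphClass := fun _ => Set.range permGraph

/-- The six parameters `=`, `≠`, `≤_l`, `≥_l`, `≤_r`, `≥_r`. -/
inductive Pattern : Type
  | eq | ne | leL | geL | leR | geR

/-- Adjacency between the `i`-th left vertex and the `j`-th right vertex in the ordered graph with
parameter `s` obtained from the ordered matching in which `i` is matched with `σ i`. -/
def Pattern.cross {n : ℕ} (s : Pattern) (σ : Equiv.Perm (Fin n)) (i j : Fin n) : Prop :=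
  match s with
  | .eq => σ i = j
  | .ne => σ i ≠ j
  | .leL => i ≤ σ.symm j
  | .geL => i ≥ σ.symm j
  | .leR => j ≤ σ i
  | .geR => j ≥ σ i

/-- The adjacency relation of the ordered graph below. -/
def matchingAdj {n : ℕ} (s : Pattern) (lam rho : Bool) (σ : Equiv.Perm (Fin n)) :
    Fin n ⊕ Fin n → Fin n ⊕ Fin n → Prop
  | .inl i, .inl j => i ≠ j ∧ lam = true
  | .inr i, .inr j => i ≠ j ∧ rho = true
  | .inl i, .inr j => s.cross σ i j
  | .inr j, .inl i => s.cross σ i j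

/-- The ordered graph with left vertices `a₁ < ... < aₙ` (the left summand), followed by right
vertices `b₁ < ... < bₙ` (the right summand; `⊕ₗ` is the lexicographically ordered sum), in which
the left vertices form a clique if `lam` and an independent set otherwise, the right vertices form
a clique if `rho` and an independent set otherwise, and the edges between left and right vertices
are given by `s` and `σ`. -/
def matchingGraph {n : ℕ} (s : Pattern) (lam rho : Bool) (σ : Equiv.Perm (Fin n)) :
    SimpleGraph (Fin n ⊕ₗ Fin n) where
  Adj u v := matchingAdj s lam rho σ (ofLex u) (ofLex v)
  symm := ⟨fun u v h => by
    rcases hu : ofLex u with i | i <;> rcases hv : ofLex v with j | j <;>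
      simp_all [matchingAdj, eq_comm]⟩
  loopless := ⟨fun u h => by
    rcases hu : ofLex u with i | i <;> simp_all [matchingAdj]⟩

/-- The hereditary closure of the class of all ordered graphs `matchingGraph s lam rho σ`. -/
def matchingClass (s : Pattern) (lam rho : Bool) : OrderedGraphClass := fun m =>
  {H | ∃ (n : ℕ) (σ : Equiv.Perm (Fin n)) (f : Fin m ↪o Fin n ⊕ₗ Fin n),
    H = (matchingGraph s lam rho σ).comap f}

end OrderedGraphClass

/-! Everything follows from a dichotomy: a hereditary class either has growth `2 ^ O(n)` or contains
one of the 25 classes (`exists_unavoidable_le_of_not_hasExpGrowth`). Each of the 25 has growth `2 ^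
ω(n)`, and they are pairwise incomparable. Hence a minimal superexponential class equals the
unavoidable class inside it, and a superexponential hereditary subclass of an unavoidable class
contains an unavoidable class, which can only be the whole.

The obstruction behind the dichotomy is `HasUniversalGrid`: an `n × n` array of cells, each holding
two rows and a column of the adjacency matrix such that the column tells the two rows apart, while
the rows agree on all columns further left in the array.

If universal grids of every size occur, Ramsey's theorem makes all adjacencies depend only on the
relative position of cells (`exists_uniformGrid`). If adjacency among rows or among columns then
depends on the position, all permutation graphs appear. If a row-column adjacency depends on it, one
of the four order patterns appears. Otherwise the entries off the diagonal are constant, and one of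
the two rows of each cell gives `=` or `≠`.

If a size `n` is missing, marks on a block division of the matrix that certify distinguishable rows
cannot contain a large grid (`exists_hasUniversalGrid_of_marks`), so by Marcus–Tardos they are
sparse. Applied twice, this gives near twins, vertices whose rows differ in boundedly many places,
in half of the blocks of bounded length (`exists_near_twins`). Deleting one twin from each of these
blocks removes a positive proportion of the vertices. A third application shows that the matrix of
differences of the twins is again free of large grids, so by Klazar's bound there are only `2 ^
O(N)` ways to restore the deleted vertices, and induction on `N` gives growth `2 ^ O(N)`. -/

/-! ### The Marcus–Tardos theorem and Klazar's counting of sparse matrices -/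

/-- A set of matrix positions has a `k`-grid if the rows and the columns can be divided into `k`
consecutive groups such that each of the `k ^ 2` cells contains a position of the set. -/
def HasGrid (S : Set (ℕ × ℕ)) (k : ℕ) : Prop :=
  ∃ I J : Fin k → Fin k → ℕ, (∀ a b, (I a b, J a b) ∈ S) ∧
    (∀ a a' b b', a < a' → I a b < I a' b') ∧ (∀ a a' b b', b < b' → J a b < J a' b')

theorem HasGrid.mono {S T : Set (ℕ × ℕ)} {k : ℕ} (h : HasGrid S k) (hST : S ⊆ T) :
    HasGrid T k := by
  obtain ⟨I, J, h1, h2, h3⟩ := h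
  exact ⟨I, J, fun a b => hST (h1 a b), h2, h3⟩

theorem HasGrid.swap {S : Set (ℕ × ℕ)} {k : ℕ} (h : HasGrid (Prod.swap ⁻¹' S) k) :
    HasGrid S k := by
  obtain ⟨I, J, h1, h2, h3⟩ := h
  exact ⟨fun a b => J b a, fun a b => I b a, fun a b => h1 b a,
    fun a a' b b' h => h3 _ _ _ _ h, fun a a' b b' h => h2 _ _ _ _ h⟩

/-- Contraction of blocks of size `t`. -/
def contract (t : ℕ) (p : ℕ × ℕ) : ℕ × ℕ := (p.1 / t, p.2 / t)

theorem Nat.lt_of_div_lt_div' {t x y : ℕ} (h : x / t < y / t) : x < y := by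
  by_contra hc
  exact absurd (Nat.div_le_div_right (c := t) (not_lt.mp hc)) (not_le.mpr h)

theorem HasGrid.of_contract {S : Set (ℕ × ℕ)} {k t : ℕ} (h : HasGrid (contract t '' S) k) :
    HasGrid S k := by
  obtain ⟨I, J, h1, h2, h3⟩ := h
  choose f hf hfe using h1
  have e1 : ∀ a b, (f a b).1 / t = I a b := fun a b => congrArg Prod.fst (hfe a b)
  have e2 : ∀ a b, (f a b).2 / t = J a b := fun a b => congrArg Prod.snd (hfe a b)
  refine ⟨fun a b => (f a b).1, fun a b => (f a b).2, hf, ?_, ?_⟩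
  · intro a a' b b' h
    exact Nat.lt_of_div_lt_div' (t := t) (by rw [e1, e1]; exact h2 _ _ _ _ h)
  · intro a a' b b' h
    exact Nat.lt_of_div_lt_div' (t := t) (by rw [e2, e2]; exact h3 _ _ _ _ h)

open Classical in
/-- The columns occurring in a block. -/
noncomputable def blockCols (S : Finset (ℕ × ℕ)) (t p q : ℕ) : Finset ℕ :=
  (Finset.Ico (q * t) (q * t + t)).filter fun c => ∃ i, i / t = p ∧ (i, c) ∈ S

/-- Pigeonhole over the `2 ^ t` possible column sets: among more than `k * 2 ^ t` wide blocks, `k`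
have the same set of at least `k` occupied columns, and these form a `k`-grid with single columns as
column groups. -/
theorem card_wide_blocks_le (S : Finset (ℕ × ℕ)) (k t N q : ℕ) (hS : ¬ HasGrid (S : Set (ℕ × ℕ)) k) :
    ((Finset.range N).filter fun p => k ≤ (blockCols S t p q).card).card ≤ k * 2 ^ t := by
  classical
  by_contra hc
  push Not at hc
  set W := (Finset.range N).filter fun p => k ≤ (blockCols S t p q).card with hW
  have hmap : ∀ p ∈ W, blockCols S t p q ∈ (Finset.Ico (q * t) (q * t + t)).powerset := by
    intro p _
    exact Finset.mem_powerset.mpr (Finset.filter_subset _ _)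
  have hcard : ((Finset.Ico (q * t) (q * t + t)).powerset).card * k < W.card := by
    rw [Finset.card_powerset, Nat.card_Ico, Nat.add_sub_cancel_left, mul_comm]
    exact hc
  obtain ⟨A, _, hA⟩ := Finset.exists_lt_card_fiber_of_mul_lt_card_of_maps_to hmap hcard
  set F := W.filter fun p => blockCols S t p q = A with hF
  have hne : F.Nonempty := Finset.card_pos.mp (by omega)
  obtain ⟨p₀, hp₀⟩ := hne
  have hAk : k ≤ A.card := by
    have h1 := (Finset.mem_filter.mp hp₀)
    have h2 := (Finset.mem_filter.mp h1.1).2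
    rwa [h1.2] at h2
  obtain ⟨F', hF'F, hF'⟩ := Finset.exists_subset_card_eq (le_of_lt hA)
  obtain ⟨A', hA'A, hA'⟩ := Finset.exists_subset_card_eq hAk
  let r := F'.orderEmbOfFin hF'
  let c := A'.orderEmbOfFin hA'
  have hw : ∀ a b, ∃ i, i / t = r a ∧ (i, c b) ∈ S := by
    intro a b
    have h1 : r a ∈ F := hF'F (F'.orderEmbOfFin_mem hF' a)
    have h2 : c b ∈ A := hA'A (A'.orderEmbOfFin_mem hA' b)
    rw [← (Finset.mem_filter.mp h1).2] at h2
    exact (Finset.mem_filter.mp h2).2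
  choose w hw1 hw2 using hw
  refine hS ⟨w, fun _ b => c b, fun a b => hw2 a b, ?_, ?_⟩
  · intro a a' b b' h
    exact Nat.lt_of_div_lt_div' (t := t) (by rw [hw1, hw1]; exact r.strictMono h)
  · intro a a' b b' h
    exact c.strictMono h

/-- A block that is neither wide nor, after transposition, tall has at most `k` occupied rows and
columns, hence at most `k ^ 2` entries. The few wide or tall blocks are allowed all `t ^ 2` entries.
-/
theorem card_le_contract (S : Finset (ℕ × ℕ)) (k t N : ℕ) (ht : 0 < t)
    (hS : ¬ HasGrid (S : Set (ℕ × ℕ)) k)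
    (hN : S.image (contract t) ⊆ Finset.range N ×ˢ Finset.range N) :
    S.card ≤ k ^ 2 * (S.image (contract t)).card + 2 * (N * (k * 2 ^ t)) * t ^ 2 := by
  classical
  let T := S.image Prod.swap
  have hT : ¬ HasGrid (T : Set (ℕ × ℕ)) k := by
    intro h
    apply hS
    apply HasGrid.swap
    refine h.mono ?_
    intro x hx
    simp only [T, Finset.coe_image, Set.mem_image, Finset.mem_coe] at hx
    obtain ⟨y, hy, rfl⟩ := hx
    simpa using hy
  let W := (Finset.range N ×ˢ Finset.range N).filter
    fun b : ℕ × ℕ => k ≤ (blockCols S t b.1 b.2).card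
  let U := (Finset.range N ×ˢ Finset.range N).filter
    fun b : ℕ × ℕ => k ≤ (blockCols T t b.2 b.1).card
  have hWc : W.card ≤ N * (k * 2 ^ t) := by
    rw [Finset.card_eq_sum_card_fiberwise (f := Prod.snd) (t := Finset.range N)]
    · calc _ ≤ ∑ _q ∈ Finset.range N, k * 2 ^ t := by
            refine Finset.sum_le_sum fun q _ => ?_
            refine le_trans ?_ (card_wide_blocks_le S k t N q hS)
            refine Finset.card_le_card_of_injOn Prod.fst ?_ ?_
            · intro x hx
              simp only [W, Finset.coe_filter, Finset.mem_filter, Finset.mem_product,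
                Set.mem_ofPred_eq, Finset.mem_range] at hx ⊢
              exact ⟨hx.1.1.1, hx.2 ▸ hx.1.2⟩
            · intro x hx y hy hxy
              simp only [Finset.coe_filter, Set.mem_ofPred_eq] at hx hy
              exact Prod.ext hxy (hx.2.trans hy.2.symm)
        _ = _ := by simp
    · intro x hx
      simp only [W, Finset.coe_filter, Finset.mem_product, Set.mem_ofPred_eq] at hx
      exact hx.1.2
  have hUc : U.card ≤ N * (k * 2 ^ t) := by
    rw [Finset.card_eq_sum_card_fiberwise (f := Prod.fst) (t := Finset.range N)]
    · calc _ ≤ ∑ _q ∈ Finset.range N, k * 2 ^ t := by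
            refine Finset.sum_le_sum fun q _ => ?_
            refine le_trans ?_ (card_wide_blocks_le T k t N q hT)
            refine Finset.card_le_card_of_injOn Prod.snd ?_ ?_
            · intro x hx
              simp only [U, Finset.coe_filter, Finset.mem_filter, Finset.mem_product,
                Set.mem_ofPred_eq, Finset.mem_range] at hx ⊢
              exact ⟨hx.1.1.2, hx.2 ▸ hx.1.2⟩
            · intro x hx y hy hxy
              simp only [Finset.coe_filter, Set.mem_ofPred_eq] at hx hy
              exact Prod.ext (hx.2.trans hy.2.symm) hxy
        _ = _ := by simp
    · intro x hx
      simp only [U, Finset.coe_filter, Finset.mem_product, Set.mem_ofPred_eq] at hx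
      exact hx.1.1
  have hmem : ∀ p : ℕ × ℕ, p ∈ S → p.2 ∈ blockCols S t (p.1 / t) (p.2 / t) := by
    intro p hp
    simp only [blockCols, Finset.mem_filter, Finset.mem_Ico]
    refine ⟨⟨Nat.div_mul_le_self _ _, ?_⟩, p.1, rfl, hp⟩
    have := Nat.lt_div_mul_add (a := p.2) ht
    omega
  have hmem' : ∀ p : ℕ × ℕ, p ∈ S → p.1 ∈ blockCols T t (p.2 / t) (p.1 / t) := by
    intro p hp
    simp only [blockCols, Finset.mem_filter, Finset.mem_Ico]
    refine ⟨⟨Nat.div_mul_le_self _ _, ?_⟩, p.2, rfl, Finset.mem_image.mpr ⟨p, hp, rfl⟩⟩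
    have := Nat.lt_div_mul_add (a := p.1) ht
    omega
  have hblock : ∀ b ∈ S.image (contract t), (S.filter fun p => contract t p = b).card ≤
      k ^ 2 + ((if b ∈ W then t ^ 2 else 0) + (if b ∈ U then t ^ 2 else 0)) := by
    intro b hb
    have hbN := hN hb
    have hsub : (S.filter fun p => contract t p = b) ⊆
        blockCols T t b.2 b.1 ×ˢ blockCols S t b.1 b.2 := by
      intro p hp
      obtain ⟨hpS, rfl⟩ := Finset.mem_filter.mp hp
      exact Finset.mem_product.mpr ⟨hmem' p hpS, hmem p hpS⟩
    have hle := Finset.card_le_card hsub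
    rw [Finset.card_product] at hle
    have h1 : ∀ R : Finset (ℕ × ℕ), ∀ p q, (blockCols R t p q).card ≤ t := by
      intro R p q
      refine (Finset.card_filter_le _ _).trans ?_
      simp
    have h2 : (blockCols T t b.2 b.1).card * (blockCols S t b.1 b.2).card ≤ t ^ 2 := by
      rw [sq]; exact Nat.mul_le_mul (h1 _ _ _) (h1 _ _ _)
    by_cases hbW : b ∈ W
    · rw [if_pos hbW]; omega
    by_cases hbU : b ∈ U
    · rw [if_pos hbU]; omega
    have h3 : (blockCols S t b.1 b.2).card ≤ k := by
      by_contra h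
      exact hbW (Finset.mem_filter.mpr ⟨hbN, by omega⟩)
    have h4 : (blockCols T t b.2 b.1).card ≤ k := by
      by_contra h
      exact hbU (Finset.mem_filter.mpr ⟨hbN, by omega⟩)
    have h5 := Nat.mul_le_mul h4 h3
    rw [← sq] at h5
    omega
  calc S.card = ∑ b ∈ S.image (contract t), (S.filter fun p => contract t p = b).card :=
        Finset.card_eq_sum_card_image _ _
    _ ≤ _ := Finset.sum_le_sum hblock
    _ ≤ k ^ 2 * (S.image (contract t)).card + (W.card * t ^ 2 + U.card * t ^ 2) := by
        rw [Finset.sum_add_distrib, Finset.sum_add_distrib, Finset.sum_const, smul_eq_mul,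
          mul_comm (k ^ 2)]
        have key : ∀ V : Finset (ℕ × ℕ), (∑ b ∈ S.image (contract t), if b ∈ V then t ^ 2 else 0) ≤
            V.card * t ^ 2 := by
          intro V
          rw [← Finset.sum_filter, Finset.sum_const, smul_eq_mul]
          refine Nat.mul_le_mul_right _ (Finset.card_le_card fun x hx => ?_)
          exact (Finset.mem_filter.mp hx).2
        gcongr
        · exact key W
        · exact key U
    _ ≤ _ := by
        have := Nat.mul_le_mul_right (t ^ 2) hWc
        have := Nat.mul_le_mul_right (t ^ 2) hUc
        linarith

theorem image_contract_subset {S : Finset (ℕ × ℕ)} {n t N : ℕ} (hN : ∀ x < n, x / t < N)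
    (hS : S ⊆ Finset.range n ×ˢ Finset.range n) :
    S.image (contract t) ⊆ Finset.range N ×ˢ Finset.range N := by
  intro b hb
  obtain ⟨p, hp, rfl⟩ := Finset.mem_image.mp hb
  have := Finset.mem_product.mp (hS hp)
  exact Finset.mem_product.mpr ⟨Finset.mem_range.mpr (hN _ (Finset.mem_range.mp this.1)),
    Finset.mem_range.mpr (hN _ (Finset.mem_range.mp this.2))⟩

/-- The Marcus–Tardos theorem. -/
theorem marcus_tardos (k : ℕ) : ∃ c : ℕ, ∀ (n : ℕ) (S : Finset (ℕ × ℕ)),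
    S ⊆ Finset.range n ×ˢ Finset.range n → ¬ HasGrid (S : Set (ℕ × ℕ)) k → S.card ≤ c * n := by
  rcases Nat.eq_zero_or_pos k with rfl | hk
  · refine ⟨0, fun n S _ h => absurd ?_ h⟩
    exact ⟨fun a => a.elim0, fun a => a.elim0, fun a => a.elim0, fun a => a.elim0,
      fun a => a.elim0⟩
  -- With this block size the recursive term `k ^ 2 * (8 * e * N)` equals `2 * e * (t * N)`, at most
  -- `4 * e * n`, so the induction closes with room for the wide and tall blocks.
  set t := 4 * k ^ 2 with ht
  have htpos : 4 ≤ t := by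
    have : 1 ≤ k ^ 2 := Nat.one_le_pow _ _ hk
    omega
  set e := k * 2 ^ t * t ^ 2 with he
  refine ⟨8 * e, fun n => ?_⟩
  induction n using Nat.strong_induction_on with
  | _ n ih =>
    intro S hS hG
    have het : t ≤ 8 * e := by
      have h1 : 1 ≤ k * 2 ^ t := Nat.mul_pos hk (by positivity)
      have h2 : t ≤ t ^ 2 := Nat.le_self_pow (by norm_num) t
      have : t ^ 2 ≤ e := by rw [he]; exact Nat.le_mul_of_pos_left _ h1
      omega
    rcases lt_or_ge n t with hnt | hnt
    · have := Finset.card_le_card hS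
      rw [Finset.card_product, Finset.card_range] at this
      exact this.trans (Nat.mul_le_mul_right _ (by omega))
    · set N := n / t + 1 with hN
      have h1 : 1 ≤ n / t := (Nat.one_le_div_iff (by omega)).mpr hnt
      have h2 : t * (n / t) ≤ n := Nat.mul_div_le n t
      have h3 : t * N ≤ 2 * n := by
        rw [hN, mul_add]; nlinarith
      have hNn : N < n := by nlinarith
      have hsub := image_contract_subset (t := t) (N := N)
        (fun x hx => Nat.lt_succ_of_le (Nat.div_le_div_right hx.le)) hS
      have h4 := card_le_contract S k t N (by omega) hG hsub
      have h5 := ih N hNn (S.image (contract t)) hsub (by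
        intro h
        apply hG
        apply HasGrid.of_contract (t := t)
        rwa [Finset.coe_image] at h)
      have h6 : 2 * (N * (k * 2 ^ t)) * t ^ 2 = 2 * e * N := by rw [he]; ring
      rw [h6] at h4
      have h7 : k ^ 2 * (S.image (contract t)).card ≤ k ^ 2 * (8 * e * N) :=
        Nat.mul_le_mul_left _ h5
      have h8 : k ^ 2 * (8 * e * N) = 2 * e * (t * N) := by rw [ht]; ring
      have h9 : 2 * e * (t * N) ≤ 2 * e * (2 * n) := Nat.mul_le_mul_left _ h3
      have h10 : 2 * e * N ≤ 2 * e * n := Nat.mul_le_mul_left _ hNn.le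
      nlinarith

/-- The sets of positions in an `n × n` matrix without a `k`-grid. -/
noncomputable def gridFree (k n : ℕ) : Finset (Finset (ℕ × ℕ)) :=
  open Classical in (Finset.range n ×ˢ Finset.range n).powerset.filter
    fun S => ¬ HasGrid (S : Set (ℕ × ℕ)) k

/-- Every `S` in the fibre is a subset of the blow-up of `T` into `2 × 2` cells. -/
theorem card_fiber_contract_le (T : Finset (ℕ × ℕ)) (F : Finset (Finset (ℕ × ℕ)))
    (hF : ∀ S ∈ F, S.image (contract 2) = T) : F.card ≤ 2 ^ (4 * T.card) := by
  classical
  let E : Finset (ℕ × ℕ) := T.biUnion fun p =>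
    ({2 * p.1, 2 * p.1 + 1} : Finset ℕ) ×ˢ ({2 * p.2, 2 * p.2 + 1} : Finset ℕ)
  have hE : E.card ≤ 4 * T.card := by
    rw [mul_comm]
    refine Finset.card_biUnion_le_card_mul _ _ _ fun p _ => ?_
    rw [Finset.card_product]
    have h1 : ∀ x : ℕ, ({2 * x, 2 * x + 1} : Finset ℕ).card ≤ 2 := fun x => Finset.card_le_two
    exact Nat.mul_le_mul (h1 _) (h1 _)
  have hsub : F ⊆ E.powerset := by
    intro S hS
    rw [Finset.mem_powerset]
    intro p hp
    refine Finset.mem_biUnion.mpr ⟨contract 2 p, ?_, ?_⟩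
    · rw [← hF S hS]; exact Finset.mem_image_of_mem _ hp
    · simp only [contract, Finset.mem_product, Finset.mem_insert, Finset.mem_singleton]
      omega
  calc F.card ≤ E.powerset.card := Finset.card_le_card hsub
    _ = 2 ^ E.card := Finset.card_powerset _
    _ ≤ _ := Nat.pow_le_pow_right (by norm_num) hE

/-- Klazar's bound for the number of `n × n` matrices without a `k`-grid. -/
theorem card_gridFree_le (k : ℕ) : ∃ c : ℕ, ∀ n, (gridFree k n).card ≤ 2 ^ (c * n) := by
  classical
  obtain ⟨c, hc⟩ := marcus_tardos k
  -- Halving costs a factor `2 ^ (4 * c * N)` with `4 * N ≤ 3 * n`, and `12 * c + 1` absorbs it: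
  -- `(16 * c + 1) * N ≤ (12 * c + 1) * n`. The summand `1` serves the base case.
  refine ⟨12 * c + 1, fun n => ?_⟩
  induction n using Nat.strong_induction_on with
  | _ n ih =>
    rcases lt_or_ge n 2 with hn | hn
    · calc (gridFree k n).card ≤ ((Finset.range n ×ˢ Finset.range n).powerset).card :=
            Finset.card_filter_le _ _
        _ = 2 ^ (n * n) := by simp [Finset.card_powerset]
        _ ≤ _ := Nat.pow_le_pow_right (by norm_num) (Nat.mul_le_mul_right _ (by omega))
    · set N := (n + 1) / 2 with hN
      have hmap : ∀ S ∈ gridFree k n, S.image (contract 2) ∈ gridFree k N := by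
        intro S hS
        obtain ⟨h1, h2⟩ := Finset.mem_filter.mp hS
        refine Finset.mem_filter.mpr ⟨Finset.mem_powerset.mpr ?_, ?_⟩
        · exact image_contract_subset (fun x hx => by omega) (Finset.mem_powerset.mp h1)
        · intro h
          apply h2
          apply HasGrid.of_contract (t := 2)
          rwa [Finset.coe_image] at h
      have h1 : (gridFree k n).card ≤ (gridFree k N).card * 2 ^ (4 * (c * N)) := by
        rw [mul_comm]
        refine Finset.card_le_mul_card_image_of_maps_to hmap _ fun T hT => ?_
        obtain ⟨h1, h2⟩ := Finset.mem_filter.mp hT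
        refine (card_fiber_contract_le T _ fun S hS => (Finset.mem_filter.mp hS).2).trans ?_
        exact Nat.pow_le_pow_right (by norm_num)
          (Nat.mul_le_mul_left _ (hc N T (Finset.mem_powerset.mp h1) h2))
      calc _ ≤ _ := h1
        _ ≤ 2 ^ ((12 * c + 1) * N) * 2 ^ (4 * (c * N)) := Nat.mul_le_mul_right _ (ih N (by omega))
        _ = 2 ^ ((12 * c + 1) * N + 4 * (c * N)) := (pow_add _ _ _).symm
        _ ≤ _ := by
            refine Nat.pow_le_pow_right (by norm_num) ?_
            have h4 : 4 * N ≤ 3 * n := by omega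
            have h5 : N ≤ n := by omega
            nlinarith [Nat.mul_le_mul_left c h4]

/-! ### Ramsey's theorem for pairs and for grids -/

/-- Take the minimum of `S`, keep a majority colour class of the remaining elements, and recurse:
the colour of a pair then depends on its smaller element only. -/
theorem exists_end_homogeneous (κ : Type) [Finite κ] [Nonempty κ] (l : ℕ) :
    ∃ N : ℕ, ∀ (α : Type) [LinearOrder α] (S : Finset α) (F : α → α → κ), N ≤ S.card →
      ∃ (g : Fin l → α) (h : Fin l → κ), StrictMono g ∧ (∀ i, g i ∈ S) ∧
        ∀ i j, i < j → F (g i) (g j) = h i := by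
  classical
  have := Fintype.ofFinite κ
  induction l with
  | zero =>
    exact ⟨0, fun α _ S F _ => ⟨fun i => i.elim0, fun i => i.elim0, fun i => i.elim0,
      fun i => i.elim0, fun i => i.elim0⟩⟩
  | succ l ih =>
    obtain ⟨N, hN⟩ := ih
    refine ⟨Fintype.card κ * N + 2, fun α _ S F hS => ?_⟩
    have hne : S.Nonempty := Finset.card_pos.mp (by omega)
    set s := S.min' hne with hs
    have hcard : (Finset.univ : Finset κ).card * N < (S.erase s).card := by
      rw [Finset.card_erase_of_mem (Finset.min'_mem _ _), Finset.card_univ]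
      omega
    obtain ⟨c, -, hc⟩ := Finset.exists_lt_card_fiber_of_mul_lt_card_of_maps_to
      (f := F s) (t := Finset.univ) (fun a _ => Finset.mem_univ _) hcard
    obtain ⟨g, h, hg, hgS, hgh⟩ := hN α _ F hc.le
    have hgS' : ∀ i, g i ∈ S ∧ s < g i ∧ F s (g i) = c := by
      intro i
      obtain ⟨h1, h2⟩ := Finset.mem_filter.mp (hgS i)
      refine ⟨Finset.mem_of_mem_erase h1, ?_, h2⟩
      exact lt_of_le_of_ne (Finset.min'_le _ _ (Finset.mem_of_mem_erase h1))
        (Finset.ne_of_mem_erase h1).symm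
    refine ⟨Fin.cons s g, Fin.cons c h, ?_, ?_, ?_⟩
    · intro i j hij
      cases j using Fin.cases with
      | zero => exact absurd hij (Fin.not_lt_zero _)
      | succ j =>
        cases i using Fin.cases with
        | zero => simpa using (hgS' j).2.1
        | succ i => simpa using hg (Fin.succ_lt_succ_iff.mp hij)
    · intro i
      cases i using Fin.cases with
      | zero => simpa using Finset.min'_mem _ _
      | succ i => simpa using (hgS' i).1
    · intro i j hij
      cases j using Fin.cases with
      | zero => exact absurd hij (Fin.not_lt_zero _)
      | succ j =>
        cases i using Fin.cases with
        | zero => simpa using (hgS' j).2.2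
        | succ i => simpa using hgh i j (Fin.succ_lt_succ_iff.mp hij)

theorem ramsey_pairs (κ : Type) [Finite κ] [Nonempty κ] (k : ℕ) :
    ∃ n : ℕ, ∀ F : Fin n → Fin n → κ, ∃ (f : Fin k → Fin n) (c : κ), StrictMono f ∧
      ∀ i j, i < j → F (f i) (f j) = c := by
  classical
  have := Fintype.ofFinite κ
  obtain ⟨n, hn⟩ := exists_end_homogeneous κ (Fintype.card κ * k + 1)
  refine ⟨n, fun F => ?_⟩
  obtain ⟨g, h, hg, -, hgh⟩ := hn (Fin n) Finset.univ F (by simp)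
  obtain ⟨c, hc⟩ := Fintype.exists_lt_card_fiber_of_mul_lt_card (n := k) h (by simp)
  obtain ⟨A, hAs, hA⟩ := Finset.exists_subset_card_eq hc.le
  refine ⟨fun i => g (A.orderEmbOfFin hA i), c, hg.comp (A.orderEmbOfFin hA).strictMono, ?_⟩
  intro i j hij
  rw [hgh _ _ ((A.orderEmbOfFin hA).strictMono hij)]
  exact (Finset.mem_filter.mp (hAs (A.orderEmbOfFin_mem hA i))).2

/-- The pair version is used on columns first, where the colour of a column pair is its whole table
over the row pairs from a fixed set of `n₁` rows, and then on these rows. -/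
theorem ramsey_grid (κ : Type) [Finite κ] [Nonempty κ] (k : ℕ) :
    ∃ n : ℕ, ∀ F : Fin n → Fin n → Fin n → Fin n → κ, ∃ (f g : Fin k → Fin n) (c : κ),
      StrictMono f ∧ StrictMono g ∧
      ∀ a a' b b', a < a' → b < b' → F (f a) (f a') (g b) (g b') = c := by
  obtain ⟨n₁, h₁⟩ := ramsey_pairs κ k
  obtain ⟨n₂, h₂⟩ := ramsey_pairs (Fin n₁ → Fin n₁ → κ) k
  refine ⟨max n₁ n₂, fun F => ?_⟩
  let i₁ : Fin n₁ → Fin (max n₁ n₂) := Fin.castLE (le_max_left _ _)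
  let i₂ : Fin n₂ → Fin (max n₁ n₂) := Fin.castLE (le_max_right _ _)
  obtain ⟨g, c, hg, hgc⟩ := h₂ fun b b' a a' => F (i₁ a) (i₁ a') (i₂ b) (i₂ b')
  obtain ⟨f, d, hf, hfd⟩ := h₁ c
  refine ⟨fun a => i₁ (f a), fun b => i₂ (g b), d, fun a a' h => hf h, fun b b' h => hg h, ?_⟩
  intro a a' b b' ha hb
  rw [← hfd a a' ha, ← hgc b b' hb]

namespace OrderedGraphClass

/-! ### Universal grids and uniform grids -/

/-- Pairs of rows and columns of the adjacency matrix of an ordered graph, arranged in an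
`n × n` grid, such that the rows of each pair are told apart by the column in the same place, but
not by the columns in the previous columns of the grid. If `o` is true then the rows come before
the columns, otherwise after them. -/
def HasUniversalGrid {N : ℕ} (G : SimpleGraph (Fin N)) (o : Bool) (n : ℕ) : Prop :=
  ∃ X Y Z : Fin n → Fin n → Fin N,
    (∀ a a' b b', a < a' → X a b < X a' b' ∧ Y a b < Y a' b') ∧
    (∀ a a' b b', b < b' → Z a b < Z a' b') ∧
    (∀ a a' b b', if o then X a b < Z a' b' ∧ Y a b < Z a' b'
      else Z a' b' < X a b ∧ Z a' b' < Y a b) ∧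
    (∀ a b, G.Adj (X a b) (Z a b) ∧ ¬ G.Adj (Y a b) (Z a b)) ∧
    (∀ a a' b b', b' < b → (G.Adj (X a b) (Z a' b') ↔ G.Adj (Y a b) (Z a' b')))

/-- A grid of rows and columns in which adjacencies depend only on the relative position. -/
structure UniformGrid {N : ℕ} (G : SimpleGraph (Fin N)) (o : Bool) {k : ℕ}
    (X Z : Fin k → Fin k → Fin N) (e f : Bool → Bool) (α : Bool → Bool → Bool) : Prop where
  row_lt : ∀ a a' b b', a < a' → X a b < X a' b'
  col_lt : ∀ a a' b b', b < b' → Z a b < Z a' b'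
  row_col : ∀ a a' b b', if o then X a b < Z a' b' else Z a' b' < X a b
  adj_row : ∀ a a' b b', a < a' → b ≠ b' → (G.Adj (X a b) (X a' b') ↔ e (decide (b < b')) = true)
  adj_col : ∀ a a' b b', b < b' → a ≠ a' → (G.Adj (Z a b) (Z a' b') ↔ f (decide (a < a')) = true)
  adj_row_col : ∀ a a' b b', a ≠ a' → b ≠ b' →
    (G.Adj (X a b) (Z a' b') ↔ α (decide (a < a')) (decide (b < b')) = true)

/-- Two cells in distinct rows and columns of the grid are placed along one diagonal direction or
the other. The bits `u` describe the increasing direction, the bits `d` the decreasing one. -/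
theorem UniformGrid.of_bits {N : ℕ} {G : SimpleGraph (Fin N)} {o : Bool} {k : ℕ}
    {X Z : Fin k → Fin k → Fin N} (h1 : ∀ a a' b b', a < a' → X a b < X a' b')
    (h2 : ∀ a a' b b', b < b' → Z a b < Z a' b')
    (h3 : ∀ a a' b b', if o then X a b < Z a' b' else Z a' b' < X a b)
    (u1 u2 u3 u4 d1 d2 d3 d4 : Bool)
    (hU : ∀ a a' b b', a < a' → b < b' → (G.Adj (X a b) (X a' b') ↔ u1 = true) ∧
      (G.Adj (Z a b) (Z a' b') ↔ u2 = true) ∧ (G.Adj (X a b) (Z a' b') ↔ u3 = true) ∧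
      (G.Adj (X a' b') (Z a b) ↔ u4 = true))
    (hD : ∀ a a' b b', a < a' → b < b' → (G.Adj (X a b') (X a' b) ↔ d1 = true) ∧
      (G.Adj (Z a b') (Z a' b) ↔ d2 = true) ∧ (G.Adj (X a b') (Z a' b) ↔ d3 = true) ∧
      (G.Adj (X a' b) (Z a b') ↔ d4 = true)) :
    UniformGrid G o X Z (fun t => if t then u1 else d1) (fun t => if t then u2 else d2)
      (fun t t' => if t' then (if t then u3 else d4) else (if t then d3 else u4)) where
  row_lt := h1
  col_lt := h2
  row_col := h3
  adj_row a a' b b' ha hb := by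
    rcases lt_or_gt_of_ne hb with hb | hb
    · simpa only [hb, decide_true, if_true] using (hU a a' b b' ha hb).1
    · simpa only [hb.not_gt, decide_false, Bool.false_eq_true, if_false] using
        (hD a a' b' b ha hb).1
  adj_col a a' b b' hb ha := by
    rcases lt_or_gt_of_ne ha with ha | ha
    · simpa only [ha, decide_true, if_true] using (hU a a' b b' ha hb).2.1
    · rw [G.adj_comm]
      simpa only [ha.not_gt, decide_false, Bool.false_eq_true, if_false] using
        (hD a' a b b' ha hb).2.1
  adj_row_col a a' b b' ha hb := by
    rcases lt_or_gt_of_ne ha with ha | ha <;> rcases lt_or_gt_of_ne hb with hb | hb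
    · simpa only [ha, hb, decide_true, if_true] using (hU a a' b b' ha hb).2.2.1
    · simpa only [ha, hb.not_gt, decide_true, if_true, decide_false, Bool.false_eq_true,
        if_false] using (hD a a' b' b ha hb).2.2.1
    · simpa only [ha.not_gt, hb, decide_true, if_true, decide_false, Bool.false_eq_true,
        if_false] using (hD a' a b b' ha hb).2.2.2
    · simpa only [ha.not_gt, hb.not_gt, decide_false, Bool.false_eq_true,
        if_false] using (hU a' a b' b ha hb).2.2.2

/-- Ramsey's theorem for grids applies to the colouring by 14 bits, namely seven adjacencies for
each of the two diagonal placements of a pair of cells. The equality of `α` and `α'` at `false`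
survives from the agreement of `X` and `Y` on columns to the left. -/
theorem exists_uniformGrid (k : ℕ) (hk : 2 ≤ k) : ∃ n : ℕ, ∀ (N : ℕ) (G : SimpleGraph (Fin N))
    (o : Bool), HasUniversalGrid G o n →
      ∃ (X Y Z : Fin k → Fin k → Fin N) (e e' f : Bool → Bool) (α α' : Bool → Bool → Bool),
        UniformGrid G o X Z e f α ∧ UniformGrid G o Y Z e' f α' ∧
        (∀ a b, G.Adj (X a b) (Z a b) ∧ ¬ G.Adj (Y a b) (Z a b)) ∧
        (∀ r, α r false = α' r false) := by
  classical
  obtain ⟨n, hn⟩ := ramsey_grid ((Fin 7 → Bool) × (Fin 7 → Bool)) k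
  refine ⟨n, fun N G o ⟨X, Y, Z, h1, h2, h3, h4, h5⟩ => ?_⟩
  let vec : Fin n → Fin n → Fin n → Fin n → Fin 7 → Prop := fun a b a' b' =>
    ![G.Adj (X a b) (X a' b'), G.Adj (Y a b) (Y a' b'), G.Adj (Z a b) (Z a' b'),
      G.Adj (X a b) (Z a' b'), G.Adj (X a' b') (Z a b), G.Adj (Y a b) (Z a' b'),
      G.Adj (Y a' b') (Z a b)]
  obtain ⟨r, s, ⟨u, d⟩, hr, hs, hrs⟩ :=
    hn fun a a' b b' => (fun t => decide (vec a b a' b' t), fun t => decide (vec a b' a' b t))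
  have hU : ∀ a a' b b', a < a' → b < b' → ∀ t, (vec (r a) (s b) (r a') (s b') t ↔ u t = true) :=
    fun a a' b b' h h' t => by
      have : decide _ = u t := congrFun (congrArg Prod.fst (hrs a a' b b' h h')) t
      rw [← this, decide_eq_true_eq]
  have hD : ∀ a a' b b', a < a' → b < b' → ∀ t, (vec (r a) (s b') (r a') (s b) t ↔ d t = true) :=
    fun a a' b b' h h' t => by
      have : decide _ = d t := congrFun (congrArg Prod.snd (hrs a a' b b' h h')) t
      rw [← this, decide_eq_true_eq]
  let i0 : Fin k := ⟨0, by omega⟩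
  let i1 : Fin k := ⟨1, by omega⟩
  have h01 : i0 < i1 := by simp [i0, i1]
  refine ⟨fun a b => X (r a) (s b), fun a b => Y (r a) (s b), fun a b => Z (r a) (s b),
    _, _, _, _, _, UniformGrid.of_bits ?_ ?_ ?_ (u 0) (u 2) (u 3) (u 4) (d 0) (d 2) (d 3) (d 4)
      ?_ ?_, UniformGrid.of_bits ?_ ?_ ?_ (u 1) (u 2) (u 5) (u 6) (d 1) (d 2) (d 5) (d 6) ?_ ?_,
      fun a b => h4 _ _, ?_⟩
  · exact fun a a' b b' h => (h1 _ _ _ _ (hr h)).1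
  · exact fun a a' b b' h => h2 _ _ _ _ (hs h)
  · intro a a' b b'
    have := h3 (r a) (r a') (s b) (s b')
    cases o <;> simp_all
  · exact fun a a' b b' ha hb => ⟨hU a a' b b' ha hb 0, hU a a' b b' ha hb 2,
      hU a a' b b' ha hb 3, hU a a' b b' ha hb 4⟩
  · exact fun a a' b b' ha hb => ⟨hD a a' b b' ha hb 0, hD a a' b b' ha hb 2,
      hD a a' b b' ha hb 3, hD a a' b b' ha hb 4⟩
  · exact fun a a' b b' h => (h1 _ _ _ _ (hr h)).2
  · exact fun a a' b b' h => h2 _ _ _ _ (hs h)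
  · intro a a' b b'
    have := h3 (r a) (r a') (s b) (s b')
    cases o <;> simp_all
  · exact fun a a' b b' ha hb => ⟨hU a a' b b' ha hb 1, hU a a' b b' ha hb 2,
      hU a a' b b' ha hb 5, hU a a' b b' ha hb 6⟩
  · exact fun a a' b b' ha hb => ⟨hD a a' b b' ha hb 1, hD a a' b b' ha hb 2,
      hD a a' b b' ha hb 5, hD a a' b b' ha hb 6⟩
  -- The entries `α r false` are the bits `u 4` and `d 3`, and those of `α'` are `u 6` and `d 5`.
  -- Comparing them needs an actual pair of cells, which exists since `2 ≤ k`.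
  · have e1 : u 4 = true ↔ u 6 = true :=
      ((hU i0 i1 i0 i1 h01 h01 4).symm.trans (h5 (r i1) (r i0) (s i1) (s i0) (hs h01))).trans
        (hU i0 i1 i0 i1 h01 h01 6)
    have e2 : d 3 = true ↔ d 5 = true :=
      ((hD i0 i1 i0 i1 h01 h01 3).symm.trans (h5 (r i0) (r i1) (s i1) (s i0) (hs h01))).trans
        (hD i0 i1 i0 i1 h01 h01 5)
    intro t
    cases t
    · simpa using Bool.eq_iff_iff.mpr e1
    · simpa using Bool.eq_iff_iff.mpr e2

/-! ### The 25 classes -/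

/-- The classes of the corollary, indexed by `none` (permutation graphs) and by triples. -/
def unavoidable : Option (Pattern × Bool × Bool) → OrderedGraphClass
  | none => permClass
  | some (s, lam, rho) => matchingClass s lam rho

/-- The given vertices form an ordered graph with pattern `s` and permutation `σ`; the right
vertices come after the left ones if `o` is true, and before them otherwise. -/
structure IsMatchingConfig {N k : ℕ} (G : SimpleGraph (Fin N)) (o : Bool) (s : Pattern)
    (lam rho : Bool) (σ : Equiv.Perm (Fin k)) (u w : Fin k → Fin N) : Prop where
  left_mono : StrictMono u
  right_mono : StrictMono w
  left_right : ∀ i j, if o then u i < w j else w j < u i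
  adj_left : ∀ i j, i < j → (G.Adj (u i) (u j) ↔ lam = true)
  adj_right : ∀ i j, i < j → (G.Adj (w i) (w j) ↔ rho = true)
  adj_left_right : ∀ i j, G.Adj (u i) (w j) ↔ s.cross σ i j

/-- The pattern obtained by exchanging the two sides. -/
def Pattern.flip : Pattern → Pattern
  | .eq => .eq
  | .ne => .ne
  | .leL => .leR
  | .geL => .geR
  | .leR => .leL
  | .geR => .geL

theorem Pattern.cross_flip {n : ℕ} (s : Pattern) (σ : Equiv.Perm (Fin n)) (i j : Fin n) :
    s.flip.cross σ.symm j i ↔ s.cross σ i j := by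
  cases s <;> simp [Pattern.flip, Pattern.cross, Equiv.symm_apply_eq, eq_comm (a := j)]

theorem IsMatchingConfig.flip {N k : ℕ} {G : SimpleGraph (Fin N)} {s : Pattern}
    {lam rho : Bool} {σ : Equiv.Perm (Fin k)} {u w : Fin k → Fin N}
    (h : IsMatchingConfig G false s lam rho σ u w) :
    IsMatchingConfig G true s.flip rho lam σ.symm w u where
  left_mono := h.right_mono
  right_mono := h.left_mono
  left_right i j := by simpa using h.left_right j i
  adj_left := h.adj_right
  adj_right := h.adj_left
  adj_left_right i j := by rw [G.adj_comm, Pattern.cross_flip, h.adj_left_right]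

/-- The class contains the generators of the given unavoidable class of order `k`. -/
def ContainsOrder (C : OrderedGraphClass) (k : ℕ) : Option (Pattern × Bool × Bool) → Prop
  | none => ∀ π : Equiv.Perm (Fin k), permGraph π ∈ C k
  | some (s, lam, rho) => ∀ σ : Equiv.Perm (Fin k), ∃ (N : ℕ) (G : SimpleGraph (Fin N)),
      G ∈ C N ∧ ∃ u w, IsMatchingConfig G true s lam rho σ u w

theorem exists_containsOrder_of_config {C : OrderedGraphClass} {N k : ℕ} {G : SimpleGraph (Fin N)}
    (hG : G ∈ C N) (o : Bool) (s : Pattern) (lam rho : Bool)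
    (h : ∀ σ : Equiv.Perm (Fin k), ∃ u w, IsMatchingConfig G o s lam rho σ u w) :
    ∃ c, ContainsOrder C k c := by
  cases o with
  | true => exact ⟨some (s, lam, rho), fun σ => ⟨N, G, hG, h σ⟩⟩
  | false =>
    refine ⟨some (s.flip, rho, lam), fun σ => ⟨N, G, hG, ?_⟩⟩
    obtain ⟨u, w, huw⟩ := h σ.symm
    exact ⟨w, u, by simpa using huw.flip⟩

/-- Vertices in increasing order, where adjacency depends on whether a pair is an inversion. -/
theorem containsOrder_none {C : OrderedGraphClass} (hC : C.IsHereditary) {N k : ℕ}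
    {G : SimpleGraph (Fin N)} (hG : G ∈ C N) (e : Bool → Bool) (he : e true ≠ e false)
    (h : ∀ τ : Equiv.Perm (Fin k), ∃ u : Fin k → Fin N, StrictMono u ∧
      ∀ i j, i < j → (G.Adj (u i) (u j) ↔ e (decide (τ i < τ j)) = true)) :
    ContainsOrder C k none := by
  intro π
  have key : ∃ u : Fin k → Fin N, StrictMono u ∧
      ∀ i j, i < j → (G.Adj (u i) (u j) ↔ π j < π i) := by
    -- If non-inversions are the edges, the hypothesis is applied to `π` followed by reversal of the
    -- values, which exchanges inversions and non-inversions.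
    rcases he' : e true with _ | _
    · obtain ⟨u, hu, hadj⟩ := h π
      refine ⟨u, hu, fun i j hij => ?_⟩
      rw [hadj i j hij]
      have hne : π i ≠ π j := fun h => hij.ne (π.injective h)
      rcases lt_or_gt_of_ne hne with h1 | h1
      · simp [h1, he', h1.not_gt]
      · simp only [h1, h1.not_gt, decide_false, iff_true]
        rw [he'] at he
        simpa using he.symm
    · obtain ⟨u, hu, hadj⟩ := h (π.trans Fin.revPerm)
      refine ⟨u, hu, fun i j hij => ?_⟩
      rw [hadj i j hij]
      have hne : π i ≠ π j := fun h => hij.ne (π.injective h)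
      have hf : e false = false := by
        rw [he'] at he
        simpa using he.symm
      rcases lt_or_gt_of_ne hne with h1 | h1
      · simp [h1.not_gt, hf]
      · simp [h1, he']
  obtain ⟨u, hu, hadj⟩ := key
  have := hC (OrderEmbedding.ofStrictMono u hu) G hG
  convert this
  ext i j
  simp only [permGraph, SimpleGraph.comap_adj, OrderEmbedding.coe_ofStrictMono]
  rcases lt_trichotomy i j with hij | rfl | hij
  · simp [hij, hij.not_gt, hadj i j hij]
  · simp
  · rw [G.adj_comm]
    simp [hij, hij.not_gt, hadj j i hij]

/-! ### Reading off an unavoidable class from a uniform grid -/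

/-- The rows in the cells `(i, τ i)` are ordered by `i`, while their adjacencies are decided by
comparing the values of `τ`. -/
theorem UniformGrid.containsOrder_none_of_rows {C : OrderedGraphClass} (hC : C.IsHereditary)
    {N k K : ℕ} {G : SimpleGraph (Fin N)} (hG : G ∈ C N) {o : Bool} {X Z : Fin K → Fin K → Fin N}
    {e f : Bool → Bool} {α : Bool → Bool → Bool} (hk : k ≤ K) (h : UniformGrid G o X Z e f α)
    (he : e true ≠ e false) : ContainsOrder C k none := by
  refine containsOrder_none hC hG e he fun τ => ?_
  refine ⟨fun i => X (Fin.castLE hk i) (Fin.castLE hk (τ i)), fun i j hij => ?_, fun i j hij => ?_⟩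
  · exact h.row_lt _ _ _ _ (by simpa using hij)
  · rw [h.adj_row _ _ _ _ (by simpa using hij) (by
      rw [Ne, Fin.castLE_inj]; exact fun h => hij.ne (τ.injective h))]
    simp

theorem UniformGrid.containsOrder_none_of_cols {C : OrderedGraphClass} (hC : C.IsHereditary)
    {N k K : ℕ} {G : SimpleGraph (Fin N)} (hG : G ∈ C N) {o : Bool} {X Z : Fin K → Fin K → Fin N}
    {e f : Bool → Bool} {α : Bool → Bool → Bool} (hk : k ≤ K) (h : UniformGrid G o X Z e f α)
    (hf : f true ≠ f false) : ContainsOrder C k none := by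
  refine containsOrder_none hC hG f hf fun τ => ?_
  refine ⟨fun i => Z (Fin.castLE hk (τ i)) (Fin.castLE hk i), fun i j hij => ?_, fun i j hij => ?_⟩
  · exact h.col_lt _ _ _ _ (by simpa using hij)
  · rw [h.adj_col _ _ _ _ (by simpa using hij) (by
      rw [Ne, Fin.castLE_inj]; exact fun h => hij.ne (τ.injective h))]
    simp

theorem eq_const_of_eq {β : Type*} {e : Bool → β} (h : e true = e false) (t : Bool) :
    e t = e true := by
  cases t
  · exact h.symm
  · rfl

/-- A placement of the rows and columns of a matching configuration in a uniform grid. -/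
theorem UniformGrid.isMatchingConfig {N k K : ℕ} {G : SimpleGraph (Fin N)} {o : Bool}
    {X Z : Fin K → Fin K → Fin N} {e f : Bool → Bool} {α : Bool → Bool → Bool}
    (h : UniformGrid G o X Z e f α) (he : e true = e false) (hf : f true = f false)
    (s : Pattern) (σ : Equiv.Perm (Fin k)) (pr pc qr qc : Fin k → Fin K)
    (hpr : StrictMono pr) (hpc : Function.Injective pc) (hqr : Function.Injective qr)
    (hqc : StrictMono qc)
    (hadj : ∀ i j, G.Adj (X (pr i) (pc i)) (Z (qr j) (qc j)) ↔ s.cross σ i j) :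
    IsMatchingConfig G o s (e true) (f true) σ (fun i => X (pr i) (pc i))
      (fun j => Z (qr j) (qc j)) where
  left_mono i j hij := h.row_lt _ _ _ _ (hpr hij)
  right_mono i j hij := h.col_lt _ _ _ _ (hqc hij)
  left_right i j := h.row_col _ _ _ _
  adj_left i j hij := by
    rw [h.adj_row _ _ _ _ (hpr hij) (fun h => hij.ne (hpc h)), eq_const_of_eq he]
  adj_right i j hij := by
    rw [h.adj_col _ _ _ _ (hqc hij) (fun h => hij.ne (hqr h)), eq_const_of_eq hf]
  adj_left_right := hadj

/-- A non-constant `α` already changes when one of its arguments changes. The other comparison is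
frozen by putting the two kinds of vertices in opposite halves of the grid. The sensitive one is
realized by interleaving even and odd positions, one kind using its own index and the other the
index of its partner. This gives the patterns `leL`, `geL`, `leR`, `geR`. -/
theorem UniformGrid.exists_containsOrder_of_ne {C : OrderedGraphClass} (hC : C.IsHereditary)
    {N k : ℕ} {G : SimpleGraph (Fin N)} (hG : G ∈ C N) {o : Bool}
    {X Z : Fin (2 * k) → Fin (2 * k) → Fin N}
    {e f : Bool → Bool} {α : Bool → Bool → Bool} (h : UniformGrid G o X Z e f α)
    (hα : ∃ r s r' s', α r s ≠ α r' s') : ∃ c, ContainsOrder C k c := by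
  by_cases he : e true = e false
  swap
  · exact ⟨none, h.containsOrder_none_of_rows hC hG (by omega) he⟩
  by_cases hf : f true = f false
  swap
  · exact ⟨none, h.containsOrder_none_of_cols hC hG (by omega) hf⟩
  let lo : Fin k → Fin (2 * k) := fun i => ⟨i, by omega⟩
  let hi : Fin k → Fin (2 * k) := fun i => ⟨k + i, by omega⟩
  let ev : Fin k → Fin (2 * k) := fun i => ⟨2 * i, by omega⟩
  let od : Fin k → Fin (2 * k) := fun i => ⟨2 * i + 1, by omega⟩
  have hlo : StrictMono lo := fun i j hij => by simpa [lo] using hij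
  have hhi : StrictMono hi := fun i j hij => by simpa [hi] using hij
  have hev : StrictMono ev := fun i j hij => by simpa [ev] using hij
  have hod : StrictMono od := fun i j hij => by simpa [od] using hij
  have hlh : ∀ i j, lo i < hi j := fun i j => by
    simp only [lo, hi, Fin.lt_def]; omega
  have heo : ∀ i j, (ev i < od j ↔ i ≤ j) := fun i j => by
    simp only [ev, od, Fin.lt_def, Fin.le_def]; omega
  have hoe : ∀ i j, (od i < ev j ↔ i < j) := fun i j => by
    simp only [ev, od, Fin.lt_def]; omega
  have hne : ∀ i j, ev i ≠ od j := fun i j => by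
    simp only [ev, od, Ne, Fin.mk.injEq]; omega
  have cases4 : (∃ s, α true s ≠ α false s) ∨ (∃ r, α r true ≠ α r false) := by
    by_contra hcon
    push Not at hcon
    obtain ⟨r, s, r', s', hrs⟩ := hα
    apply hrs
    rw [eq_const_of_eq (e := α r) (hcon.2 r), eq_const_of_eq (e := α r') (hcon.2 r'),
      eq_const_of_eq (e := fun t => α t true) (hcon.1 true) r,
      eq_const_of_eq (e := fun t => α t true) (hcon.1 true) r']
  rcases cases4 with ⟨s, hs⟩ | ⟨r, hr⟩
  -- All column coordinates of the left vertices lie on the same side of those of the right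
  -- vertices, so the second argument of `α` is always `s`.
  · have hcols : ∃ pc qc : Fin k → Fin (2 * k), StrictMono pc ∧ StrictMono qc ∧
        ∀ i j, pc i ≠ qc j ∧ decide (pc i < qc j) = s := by
      cases s
      · exact ⟨hi, lo, hhi, hlo, fun i j => ⟨(hlh j i).ne', by simpa using (hlh j i).le⟩⟩
      · exact ⟨lo, hi, hlo, hhi, fun i j => ⟨(hlh i j).ne, by simpa using hlh i j⟩⟩
    obtain ⟨pc, qc, hpc, hqc, hpq⟩ := hcols
    rcases hT : α true s with _ | _
    · have hF : α false s = true := by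
        rw [hT] at hs; simpa using hs.symm
      refine exists_containsOrder_of_config hG o .geL (e true) (f true) fun σ => ?_
      refine ⟨_, _, h.isMatchingConfig he hf .geL σ od pc (fun j => ev (σ.symm j)) qc hod
        hpc.injective (hev.injective.comp σ.symm.injective) hqc fun i j => ?_⟩
      rw [h.adj_row_col _ _ _ _ (hne _ _).symm (hpq i j).1, (hpq i j).2]
      by_cases hlt : i < σ.symm j
      · simp [(hoe _ _).mpr hlt, hT, Pattern.cross, hlt]
      · simp [mt (hoe _ _).mp hlt, hF, Pattern.cross, not_lt.mp hlt]
    · have hF : α false s = false := by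
        rw [hT] at hs; simpa using hs.symm
      refine exists_containsOrder_of_config hG o .leL (e true) (f true) fun σ => ?_
      refine ⟨_, _, h.isMatchingConfig he hf .leL σ ev pc (fun j => od (σ.symm j)) qc hev
        hpc.injective (hod.injective.comp σ.symm.injective) hqc fun i j => ?_⟩
      rw [h.adj_row_col _ _ _ _ (hne _ _) (hpq i j).1, (hpq i j).2]
      by_cases hlt : i ≤ σ.symm j
      · simp [(heo _ _).mpr hlt, hT, Pattern.cross, hlt]
      · simp [mt (heo _ _).mp hlt, hF, Pattern.cross, hlt]
  · have hrows : ∃ pr qr : Fin k → Fin (2 * k), StrictMono pr ∧ StrictMono qr ∧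
        ∀ i j, pr i ≠ qr j ∧ decide (pr i < qr j) = r := by
      cases r
      · exact ⟨hi, lo, hhi, hlo, fun i j => ⟨(hlh j i).ne', by simpa using (hlh j i).le⟩⟩
      · exact ⟨lo, hi, hlo, hhi, fun i j => ⟨(hlh i j).ne, by simpa using hlh i j⟩⟩
    obtain ⟨pr, qr, hpr, hqr, hpq⟩ := hrows
    rcases hT : α r true with _ | _
    · have hF : α r false = true := by
        rw [hT] at hr; simpa using hr.symm
      refine exists_containsOrder_of_config hG o .leR (e true) (f true) fun σ => ?_
      refine ⟨_, _, h.isMatchingConfig he hf .leR σ pr (fun i => od (σ i)) qr ev hpr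
        (hod.injective.comp σ.injective) hqr.injective hev fun i j => ?_⟩
      rw [h.adj_row_col _ _ _ _ (hpq i j).1 (hne _ _).symm, (hpq i j).2]
      by_cases hlt : σ i < j
      · simp [(hoe _ _).mpr hlt, hT, Pattern.cross, hlt]
      · simp [mt (hoe _ _).mp hlt, hF, Pattern.cross, not_lt.mp hlt]
    · have hF : α r false = false := by
        rw [hT] at hr; simpa using hr.symm
      refine exists_containsOrder_of_config hG o .geR (e true) (f true) fun σ => ?_
      refine ⟨_, _, h.isMatchingConfig he hf .geR σ pr (fun i => ev (σ i)) qr od hpr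
        (hev.injective.comp σ.injective) hqr.injective hod fun i j => ?_⟩
      rw [h.adj_row_col _ _ _ _ (hpq i j).1 (hne _ _), (hpq i j).2]
      by_cases hlt : σ i ≤ j
      · simp [(heo _ _).mpr hlt, hT, Pattern.cross, hlt]
      · simp [mt (heo _ _).mp hlt, hF, Pattern.cross, hlt]

/-- Left vertex `i` sits in the cell `(i, σ i)` and right vertex `j` in `(σ⁻¹ j, j)`: matched
vertices share a cell, and unmatched ones lie in cells differing in both coordinates. -/
theorem UniformGrid.exists_containsOrder_of_const {C : OrderedGraphClass} (hC : C.IsHereditary)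
    {N k K : ℕ} (hk : k ≤ K) {G : SimpleGraph (Fin N)} (hG : G ∈ C N) {o : Bool}
    {X Z : Fin K → Fin K → Fin N} {e f : Bool → Bool} {α : Bool → Bool → Bool}
    (h : UniformGrid G o X Z e f α) (s : Pattern)
    (hs : ∀ (σ : Equiv.Perm (Fin k)) (i j : Fin k),
      G.Adj (X (Fin.castLE hk i) (Fin.castLE hk (σ i)))
        (Z (Fin.castLE hk (σ.symm j)) (Fin.castLE hk j)) ↔ s.cross σ i j) :
    ∃ c, ContainsOrder C k c := by
  by_cases he : e true = e false
  swap
  · exact ⟨none, h.containsOrder_none_of_rows hC hG hk he⟩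
  by_cases hf : f true = f false
  swap
  · exact ⟨none, h.containsOrder_none_of_cols hC hG hk hf⟩
  refine exists_containsOrder_of_config hG o s (e true) (f true) fun σ => ?_
  have hc : StrictMono (Fin.castLE hk) := Fin.strictMono_castLE hk
  exact ⟨_, _, h.isMatchingConfig he hf s σ (Fin.castLE hk) (fun i => Fin.castLE hk (σ i))
    (fun j => Fin.castLE hk (σ.symm j)) (Fin.castLE hk) hc (hc.injective.comp σ.injective)
    (hc.injective.comp σ.symm.injective) hc (hs σ)⟩

/-- When `α` and `α'` are both constant, they are the same constant. If it is `false`, the rows `X`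
are adjacent exactly to the matched columns; if it is `true`, the rows `Y` miss exactly these. -/
theorem exists_containsOrder (k : ℕ) : ∃ n : ℕ, ∀ (C : OrderedGraphClass), C.IsHereditary →
    ∀ (N : ℕ) (G : SimpleGraph (Fin N)) (o : Bool), G ∈ C N → HasUniversalGrid G o n →
      ∃ c, ContainsOrder C (k + 1) c := by
  obtain ⟨n, hn⟩ := exists_uniformGrid (2 * (k + 1)) (by omega)
  refine ⟨n, fun C hC N G o hG hgrid => ?_⟩
  obtain ⟨X, Y, Z, e, e', f, α, α', hX, hY, hXY, hαα⟩ := hn N G o hgrid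
  by_cases hα : ∃ r s r' s', α r s ≠ α r' s'
  · exact hX.exists_containsOrder_of_ne hC hG hα
  by_cases hα' : ∃ r s r' s', α' r s ≠ α' r' s'
  · exact hY.exists_containsOrder_of_ne hC hG hα'
  push Not at hα hα'
  have hk : k + 1 ≤ 2 * (k + 1) := by omega
  have hoff : ∀ (σ : Equiv.Perm (Fin (k + 1))) (i j), σ i ≠ j →
      Fin.castLE hk i ≠ Fin.castLE hk (σ.symm j) ∧ Fin.castLE hk (σ i) ≠ Fin.castLE hk j := by
    intro σ i j hij
    rw [Ne, Fin.castLE_inj, Ne, Fin.castLE_inj, Equiv.eq_symm_apply]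
    exact ⟨hij, hij⟩
  rcases hT : α true false with _ | _
  · refine hX.exists_containsOrder_of_const hC hk hG .eq fun σ i j => ?_
    by_cases hij : σ i = j
    · subst hij
      simpa [Pattern.cross] using (hXY _ _).1
    · rw [hX.adj_row_col _ _ _ _ (hoff σ i j hij).1 (hoff σ i j hij).2, hα _ _ true false, hT]
      simp [Pattern.cross, hij]
  · refine hY.exists_containsOrder_of_const hC hk hG .ne fun σ i j => ?_
    by_cases hij : σ i = j
    · subst hij
      simpa [Pattern.cross] using (hXY _ _).2
    · rw [hY.adj_row_col _ _ _ _ (hoff σ i j hij).1 (hoff σ i j hij).2, hα' _ _ true false,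
        ← hαα, hT]
      simp [Pattern.cross, hij]

/-! ### Hereditary closure and generators of unbounded order -/

theorem exists_perm_extension {n m : ℕ} (h : n ≤ m) (σ : Equiv.Perm (Fin n)) :
    ∃ τ : Equiv.Perm (Fin m), ∀ i, τ (Fin.castLE h i) = Fin.castLE h (σ i) :=
  ⟨σ.viaFintypeEmbedding (Fin.castLEEmb h),
    fun i => Equiv.Perm.viaFintypeEmbedding_apply_image _ _ i⟩

theorem Pattern.cross_castLE {n m : ℕ} (h : n ≤ m) {σ : Equiv.Perm (Fin n)}
    {τ : Equiv.Perm (Fin m)} (hτ : ∀ i, τ (Fin.castLE h i) = Fin.castLE h (σ i)) (s : Pattern)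
    (i j : Fin n) : s.cross τ (Fin.castLE h i) (Fin.castLE h j) ↔ s.cross σ i j := by
  have hsymm : τ.symm (Fin.castLE h j) = Fin.castLE h (σ.symm j) := by
    rw [Equiv.symm_apply_eq, hτ, Equiv.apply_symm_apply]
  cases s <;> simp [Pattern.cross, hτ, hsymm]

theorem isHereditary_permClass : IsHereditary permClass := by
  rintro m n f _ ⟨π, rfl⟩
  let g : Fin m → Fin n := fun i => π (f i)
  have hg : Function.Injective g := π.injective.comp f.injective
  let A : Finset (Fin n) := Finset.univ.image g
  have hA : A.card = m := by
    rw [Finset.card_image_of_injective _ hg, Finset.card_univ, Fintype.card_fin]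
  let τ : Fin m → Fin m := fun i => (A.orderIsoOfFin hA).symm
    ⟨g i, Finset.mem_image_of_mem _ (Finset.mem_univ i)⟩
  have hτ : ∀ i j, τ i < τ j ↔ g i < g j := fun i j => by
    simp only [τ, OrderIso.lt_iff_lt, Subtype.mk_lt_mk]
  have hinj : Function.Injective τ := fun i j h => by
    by_contra hne
    rcases lt_or_gt_of_ne (fun h => hne (hg h)) with h1 | h1
    · exact (((hτ _ _).mpr h1).ne h).elim
    · exact (((hτ _ _).mpr h1).ne h.symm).elim
  refine ⟨Equiv.ofBijective τ (Finite.injective_iff_bijective.mp hinj), ?_⟩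
  ext i j
  simp [permGraph, hτ, g]

theorem isHereditary_matchingClass (s : Pattern) (lam rho : Bool) :
    IsHereditary (matchingClass s lam rho) := by
  rintro m n f _ ⟨N, σ, g, rfl⟩
  exact ⟨N, σ, f.trans g, by rw [SimpleGraph.comap_comap]; rfl⟩

theorem isHereditary_unavoidable : ∀ c, IsHereditary (unavoidable c)
  | none => isHereditary_permClass
  | some (s, lam, rho) => isHereditary_matchingClass s lam rho

theorem IsMatchingConfig.exists_embedding {N k : ℕ} {G : SimpleGraph (Fin N)} {s : Pattern}
    {lam rho : Bool} {σ : Equiv.Perm (Fin k)} {u w : Fin k → Fin N}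
    (h : IsMatchingConfig G true s lam rho σ u w) :
    ∃ g : Fin k ⊕ₗ Fin k ↪o Fin N, G.comap g = matchingGraph s lam rho σ := by
  have hlt : ∀ i j, u i < w j := fun i j => by simpa using h.left_right i j
  let g : Fin k ⊕ₗ Fin k → Fin N := fun x => Sum.elim u w (ofLex x)
  have hg : StrictMono g := by
    intro x y hxy
    induction x using Lex.rec with | _ x
    induction y using Lex.rec with | _ y
    rcases x with x | x <;> rcases y with y | y
    · exact h.left_mono (by simpa using hxy)
    · exact hlt x y
    · simp at hxy
    · exact h.right_mono (by simpa using hxy)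
  refine ⟨OrderEmbedding.ofStrictMono g hg, ?_⟩
  have key : ∀ (v : Fin k → Fin N) (b : Bool), StrictMono v →
      (∀ i j, i < j → (G.Adj (v i) (v j) ↔ b = true)) →
      ∀ i j, (G.Adj (v i) (v j) ↔ i ≠ j ∧ b = true) := by
    intro v b _ hv i j
    rcases lt_trichotomy i j with hij | rfl | hij
    · simp [hv i j hij, hij.ne]
    · simp
    · rw [G.adj_comm]
      simp [hv j i hij, hij.ne']
  ext x y
  induction x using Lex.rec with | _ x
  induction y using Lex.rec with | _ y
  rcases x with x | x <;> rcases y with y | y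
  · exact key u lam h.left_mono h.adj_left x y
  · exact h.adj_left_right x y
  · exact (G.adj_comm _ _).trans (h.adj_left_right y x)
  · exact key w rho h.right_mono h.adj_right x y

/-- A permutation of a smaller order extends by fixed points to the larger order `k`, so generators
of arbitrarily large orders yield those of all orders. -/
theorem ContainsOrder.unavoidable_mem {C : OrderedGraphClass} (hC : C.IsHereditary)
    {c : Option (Pattern × Bool × Bool)} (h : ∀ n, ∃ k, n ≤ k ∧ ContainsOrder C k c) :
    unavoidable c ≤ C := by
  intro n H hH
  rcases c with _ | ⟨s, lam, rho⟩
  · obtain ⟨π, rfl⟩ := hH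
    obtain ⟨k, hk, hcont⟩ := h n
    obtain ⟨τ, hτ⟩ := exists_perm_extension hk π
    have := hC (Fin.castLEOrderEmb hk) _ (hcont τ)
    convert this
    ext i j
    simp [permGraph, hτ]
  · obtain ⟨m, σ, f, rfl⟩ := hH
    obtain ⟨k, hk, hcont⟩ := h m
    obtain ⟨τ, hτ⟩ := exists_perm_extension hk σ
    obtain ⟨N, G, hG, u, w, huw⟩ := hcont τ
    have hc : StrictMono (Fin.castLE hk) := Fin.strictMono_castLE hk
    have huw' : IsMatchingConfig G true s lam rho σ (fun i => u (Fin.castLE hk i))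
        (fun i => w (Fin.castLE hk i)) :=
      { left_mono := huw.left_mono.comp hc
        right_mono := huw.right_mono.comp hc
        left_right := fun i j => huw.left_right _ _
        adj_left := fun i j hij => huw.adj_left _ _ (hc hij)
        adj_right := fun i j hij => huw.adj_right _ _ (hc hij)
        adj_left_right := fun i j => by
          rw [huw.adj_left_right, Pattern.cross_castLE hk hτ] }
    obtain ⟨g, hg⟩ := huw'.exists_embedding
    rw [← hg, SimpleGraph.comap_comap]
    exact hC (f.trans g) G hG

instance : DecidableEq Pattern := fun s t => by
  cases s <;> cases t <;> first
    | exact isTrue rfl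
    | exact isFalse (fun h => Pattern.noConfusion h)

instance : Fintype Pattern where
  elems := {.eq, .ne, .leL, .geL, .leR, .geR}
  complete s := by cases s <;> decide

/-- A hereditary class with arbitrarily large universal grids contains an unavoidable class. -/
theorem exists_unavoidable_le {C : OrderedGraphClass} (hC : C.IsHereditary)
    (h : ∀ n, ∃ (N : ℕ) (G : SimpleGraph (Fin N)) (o : Bool), G ∈ C N ∧ HasUniversalGrid G o n) :
    ∃ c, unavoidable c ≤ C := by
  have h1 : ∀ k, ∃ c, ContainsOrder C (k + 1) c := by
    intro k
    obtain ⟨n, hn⟩ := exists_containsOrder k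
    obtain ⟨N, G, o, hG, hgrid⟩ := h n
    exact hn C hC N G o hG hgrid
  choose c hc using h1
  -- There are finitely many candidate classes, so one of them serves infinitely many orders.
  obtain ⟨d, hd⟩ := Finite.exists_infinite_fiber c
  refine ⟨d, ContainsOrder.unavoidable_mem hC fun n => ?_⟩
  obtain ⟨k, hk, hkn⟩ := (Set.infinite_coe_iff.mp hd).exists_gt n
  exact ⟨k + 1, by omega, by rw [← show c k = d from hk]; exact hc k⟩

end OrderedGraphClass

namespace OrderedGraphClass

/-! ### From grids of marked blocks to universal grids -/

/-- Compare the lower half of the row groups with the upper half of the column groups. If not every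
row precedes every column there, a single violation forces all columns in the lower half of the
column groups to precede all rows in the upper half of the row groups. -/
theorem exists_oriented_grid {S : Set (ℕ × ℕ)} {K N : ℕ} (L₁ L₂ : ℕ) (h : HasGrid S (2 * K)) :
    ∃ (o : Bool) (I J : Fin K → Fin K → ℕ), (∀ a b, (I a b, J a b) ∈ S) ∧
      (∀ a a' b b', a < a' → I a b < I a' b') ∧ (∀ a a' b b', b < b' → J a b < J a' b') ∧
      ∀ (a a' b b' : Fin K) (x c : Fin N), x / L₁ = I a b → c / L₂ = J a' b' →
        if o then x < c else c < x := by
  obtain ⟨I, J, hS, hI, hJ⟩ := h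
  let lo : Fin K → Fin (2 * K) := fun i => ⟨i, by omega⟩
  let hi : Fin K → Fin (2 * K) := fun i => ⟨K + i, by omega⟩
  have hlo : StrictMono lo := fun i j hij => by simpa [lo] using hij
  have hhi : StrictMono hi := fun i j hij => by simpa [hi] using hij
  have hlh : ∀ i j, lo i < hi j := fun i j => by
    simp only [lo, hi, Fin.lt_def]; omega
  by_cases hc : ∀ (a a' b b' : Fin K) (x c : Fin N), x / L₁ = I (lo a) (hi b) →
      c / L₂ = J (lo a') (hi b') → x < c
  · exact ⟨true, fun a b => I (lo a) (hi b), fun a b => J (lo a) (hi b), fun a b => hS _ _,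
      fun a a' b b' h => hI _ _ _ _ (hlo h), fun a a' b b' h => hJ _ _ _ _ (hhi h), hc⟩
  · push Not at hc
    obtain ⟨a₁, a₂, b₁, b₂, x₁, c₁, hx₁, hc₁, hcx⟩ := hc
    refine ⟨false, fun a b => I (hi a) (lo b), fun a b => J (hi a) (lo b), fun a b => hS _ _,
      fun a a' b b' h => hI _ _ _ _ (hhi h), fun a a' b b' h => hJ _ _ _ _ (hlo h), ?_⟩
    intro a a' b b' x c hx hc
    have h1 : x₁ < x := Nat.lt_of_div_lt_div' (t := L₁) (by
      rw [hx₁, hx]; exact hI _ _ _ _ (hlh _ _))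
    have h2 : c < c₁ := Nat.lt_of_div_lt_div' (t := L₂) (by
      rw [hc₁, hc]; exact hJ _ _ _ _ (hlh _ _))
    simpa using h2.trans_le (hcx.trans h1.le)

/-- Column groups of a grid can be chosen, from right to left, so that the exceptional sets of
the chosen cells are avoided by the chosen cells to the left of them. -/
theorem exists_conflict_free {n m w K : ℕ} (hw : n * n * m < w) (hK : K = n * w)
    (I J : Fin n → Fin K → ℕ) (hJ : ∀ a a' b b', b < b' → J a b < J a' b')
    (E : ℕ → Finset ℕ) (hE : ∀ i, (E i).card ≤ m) :
    ∃ g : Fin n → Fin K, StrictMono g ∧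
      ∀ b b', b < b' → ∀ a a', J a' (g b) ∉ E (I a (g b')) := by
  classical
  have hlt : ∀ (b : Fin n) (q : Fin w), b * w + q < K := by
    intro b q
    have : (b + 1 : ℕ) * w ≤ n * w := Nat.mul_le_mul_right _ b.2
    rw [add_mul, one_mul] at this
    omega
  have key : ∀ l ≤ n, ∃ g : Fin n → Fin w, ∀ b b' : Fin n, n - l ≤ b → b < b' → ∀ a a',
      J a' ⟨b * w + g b, hlt _ _⟩ ∉ E (I a ⟨b' * w + g b', hlt _ _⟩) := by
    intro l
    induction l with
    | zero =>
      intro _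
      exact ⟨fun _ => ⟨0, by omega⟩, fun b b' h => absurd b.2 (by omega)⟩
    | succ l ih =>
      intro hl
      obtain ⟨g, hg⟩ := ih (by omega)
      let β : Fin n := ⟨n - (l + 1), by omega⟩
      let F : Finset ℕ := (Finset.univ : Finset (Fin n × Fin n)).biUnion fun p =>
        E (I p.1 ⟨p.2 * w + g p.2, hlt _ _⟩)
      have hF : F.card < w := by
        refine lt_of_le_of_lt (Finset.card_biUnion_le_card_mul _ _ m fun p _ => hE _) ?_
        simpa using hw
      have hq : ∃ q : Fin w, ∀ a', J a' ⟨β * w + q, hlt _ _⟩ ∉ F := by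
        by_contra hcon
        push Not at hcon
        choose a ha using hcon
        -- An exceptional value excludes at most one of the `w` candidates, since distinct
        -- candidates have distinct values of `J` in whichever rows.
        have hinj : Function.Injective fun q : Fin w => J (a q) ⟨β * w + q, hlt _ _⟩ := by
          intro q q' hqq
          by_contra hne
          rcases lt_or_gt_of_ne hne with h | h
          · exact (hJ (a q) (a q') _ _ (by simpa using h)).ne hqq
          · exact (hJ (a q') (a q) _ _ (by simpa using h)).ne hqq.symm
        have := Finset.card_le_card_of_injOn (s := Finset.univ) (t := F) _
          (fun q _ => ha q) hinj.injOn
        rw [Finset.card_univ, Fintype.card_fin] at this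
        omega
      obtain ⟨q, hq⟩ := hq
      refine ⟨Function.update g β q, fun b b' hb hbb' a a' => ?_⟩
      have hb' : b' ≠ β := by
        rintro rfl
        have : (b : ℕ) < n - (l + 1) := hbb'
        omega
      simp only [Function.update_of_ne hb']
      by_cases hbβ : b = β
      · subst hbβ
        simp only [Function.update_self]
        intro hmem
        exact hq a' (Finset.mem_biUnion.mpr ⟨(a, b'), Finset.mem_univ _, hmem⟩)
      · simp only [Function.update_of_ne hbβ]
        refine hg b b' ?_ hbb' a a'
        have : (b : ℕ) ≠ n - (l + 1) := fun h => hbβ (Fin.ext h)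
        omega
  obtain ⟨g, hg⟩ := key n le_rfl
  refine ⟨fun b => ⟨b * w + g b, hlt _ _⟩, fun b b' hbb' => ?_, fun b b' h => hg b b' (by omega) h⟩
  have h1 : (b + 1 : ℕ) * w ≤ b' * w := Nat.mul_le_mul_right _ hbb'
  rw [add_mul, one_mul] at h1
  simp only [Fin.mk_lt_mk]
  omega

/-- If in each cell of a conflict-free grid we can find pairs of rows told apart by a column, and
agreeing on any few given columns to the left of it, then there is a universal grid. -/
theorem hasUniversalGrid_of_cells {n N : ℕ} {G : SimpleGraph (Fin N)} (L₁ L₂ : ℕ) (o : Bool)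
    (I J : Fin n → Fin n → ℕ)
    (hI : ∀ a a' b b', a < a' → I a b < I a' b') (hJ : ∀ a a' b b', b < b' → J a b < J a' b')
    (ho : ∀ (a a' b b' : Fin n) (x c : Fin N), x / L₁ = I a b → c / L₂ = J a' b' →
        if o then x < c else c < x)
    (E : ℕ → Finset ℕ) (hE : ∀ b b', b < b' → ∀ a a', J a' b ∉ E (I a b'))
    (hmark : ∀ a b, ∀ T : Finset (Fin N), T.card ≤ n ^ 2 →
      (∀ z ∈ T, (z : ℕ) / L₂ < J a b ∧ (z : ℕ) / L₂ ∉ E (I a b)) →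
      ∃ x y c : Fin N, x / L₁ = I a b ∧ y / L₁ = I a b ∧ c / L₂ = J a b ∧ G.Adj x c ∧
        ¬ G.Adj y c ∧ ∀ z ∈ T, (G.Adj x z ↔ G.Adj y z)) :
    HasUniversalGrid G o n := by
  classical
  rcases Nat.eq_zero_or_pos n with rfl | hn
  · exact ⟨fun a => a.elim0, fun a => a.elim0, fun a => a.elim0, fun a => a.elim0,
      fun a => a.elim0, fun a => a.elim0, fun a => a.elim0, fun a => a.elim0⟩
  obtain ⟨x₀, -⟩ := hmark ⟨0, hn⟩ ⟨0, hn⟩ ∅ (by simp) (by simp)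
  have key : ∀ l ≤ n, ∃ X Y Z : Fin n → Fin n → Fin N, ∀ a b : Fin n, (b : ℕ) < l →
      X a b / L₁ = I a b ∧ Y a b / L₁ = I a b ∧ Z a b / L₂ = J a b ∧ G.Adj (X a b) (Z a b) ∧
        ¬ G.Adj (Y a b) (Z a b) ∧
        ∀ a' b', b' < b → (G.Adj (X a b) (Z a' b') ↔ G.Adj (Y a b) (Z a' b')) := by
    intro l
    induction l with
    | zero =>
      intro _
      exact ⟨fun _ _ => x₀, fun _ _ => x₀, fun _ _ => x₀, fun a b h => absurd h (by omega)⟩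
    | succ l ih =>
      intro hl
      obtain ⟨X, Y, Z, hXYZ⟩ := ih (by omega)
      let β : Fin n := ⟨l, by omega⟩
      -- The universal grid is built from left to right; `T` consists of the columns chosen so far,
      -- on which the next pairs of rows have to agree.
      let T : Finset (Fin N) := ((Finset.univ : Finset (Fin n × Fin n)).filter
        fun p => p.2 < β).image fun p => Z p.1 p.2
      have hT : T.card ≤ n ^ 2 := by
        refine Finset.card_image_le.trans ((Finset.card_filter_le _ _).trans ?_)
        simp [sq]
      have hmem : ∀ a b, b < β → Z a b ∈ T := fun a b h =>
        Finset.mem_image.mpr ⟨(a, b), by simpa using h, rfl⟩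
      have hsel := fun a => hmark a β T hT (by
        intro z hz
        obtain ⟨p, hp, rfl⟩ := Finset.mem_image.mp hz
        have hp2 := (Finset.mem_filter.mp hp).2
        rw [(hXYZ p.1 p.2 hp2).2.2.1]
        exact ⟨hJ _ _ _ _ hp2, hE _ _ hp2 _ _⟩)
      choose x y c h1 h2 h3 h4 h5 h6 using hsel
      refine ⟨fun a b => if b = β then x a else X a b, fun a b => if b = β then y a else Y a b,
        fun a b => if b = β then c a else Z a b, fun a b hb => ?_⟩
      by_cases hbβ : b = β
      · subst hbβ
        simp only [if_true]
        refine ⟨h1 a, h2 a, h3 a, h4 a, h5 a, fun a' b' hb' => ?_⟩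
        simp only [hb'.ne, if_false]
        exact h6 a _ (hmem a' b' hb')
      · have hbl : (b : ℕ) < l := by
          have : (b : ℕ) ≠ l := fun h => hbβ (Fin.ext h)
          omega
        simp only [hbβ, if_false]
        obtain ⟨g1, g2, g3, g4, g5, g6⟩ := hXYZ a b hbl
        refine ⟨g1, g2, g3, g4, g5, fun a' b' hb' => ?_⟩
        have : b' ≠ β := by
          rintro rfl
          exact absurd (show l < (b : ℕ) from hb') (by omega)
        simp only [this, if_false]
        exact g6 a' b' hb'
  obtain ⟨X, Y, Z, h⟩ := key n le_rfl
  refine ⟨X, Y, Z, ?_, ?_, ?_, ?_, ?_⟩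
  · intro a a' b b' haa
    obtain ⟨h1, h2, -⟩ := h a b b.2
    obtain ⟨h1', h2', -⟩ := h a' b' b'.2
    constructor
    · exact Nat.lt_of_div_lt_div' (t := L₁) (by rw [h1, h1']; exact hI _ _ _ _ haa)
    · exact Nat.lt_of_div_lt_div' (t := L₁) (by rw [h2, h2']; exact hI _ _ _ _ haa)
  · intro a a' b b' hbb
    exact Nat.lt_of_div_lt_div' (t := L₂) (by
      rw [(h a b b.2).2.2.1, (h a' b' b'.2).2.2.1]; exact hJ _ _ _ _ hbb)
  · intro a a' b b'
    have h1 := ho a a' b b' _ _ (h a b b.2).1 (h a' b' b'.2).2.2.1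
    have h2 := ho a a' b b' _ _ (h a b b.2).2.1 (h a' b' b'.2).2.2.1
    cases o <;> simp_all
  · exact fun a b => ⟨(h a b b.2).2.2.2.1, (h a b b.2).2.2.2.2.1⟩
  · exact fun a a' b b' hb => (h a b b.2).2.2.2.2.2 a' b' hb

/-- A mark `(i, j)` promises rows in block `i` told apart in block `j` but agreeing on any `n ^ 2`
earlier columns outside the exceptional blocks `E i`. The grid of marks is first oriented, then
thinned so that the exceptional blocks never matter. This form covers rich blocks, split blocks and
differences of twins alike. -/
theorem exists_hasUniversalGrid_of_marks (n m : ℕ) : ∃ k : ℕ, ∀ (N : ℕ) (G : SimpleGraph (Fin N))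
    (L₁ L₂ : ℕ) (S : Set (ℕ × ℕ)) (E : ℕ → Finset ℕ), (∀ i, (E i).card ≤ m) →
    (∀ p ∈ S, ∀ T : Finset (Fin N), T.card ≤ n ^ 2 →
      (∀ z ∈ T, (z : ℕ) / L₂ < p.2 ∧ (z : ℕ) / L₂ ∉ E p.1) →
      ∃ x y c : Fin N, x / L₁ = p.1 ∧ y / L₁ = p.1 ∧ c / L₂ = p.2 ∧ G.Adj x c ∧
        ¬ G.Adj y c ∧ ∀ z ∈ T, (G.Adj x z ↔ G.Adj y z)) →
    HasGrid S k → ∃ o, HasUniversalGrid G o n := by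
  set w := n * n * m + 1 with hw
  refine ⟨2 * (n * w), fun N G L₁ L₂ S E hE hmark hgrid => ?_⟩
  obtain ⟨o, I, J, hS, hI, hJ, ho⟩ := exists_oriented_grid (N := N) L₁ L₂ hgrid
  have hn : n ≤ n * w := Nat.le_mul_of_pos_right _ (by omega)
  have hc : StrictMono (Fin.castLE hn) := Fin.strictMono_castLE hn
  obtain ⟨g, hg, hgE⟩ := exists_conflict_free (n := n) (m := m) (w := w) (by omega) rfl
    (fun a b => I (Fin.castLE hn a) b) (fun a b => J (Fin.castLE hn a) b)
    (fun a a' b b' h => hJ _ _ _ _ h) E hE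
  exact ⟨o, hasUniversalGrid_of_cells L₁ L₂ o (fun a b => I (Fin.castLE hn a) (g b))
    (fun a b => J (Fin.castLE hn a) (g b)) (fun a a' b b' h => hI _ _ _ _ (hc h))
    (fun a a' b b' h => hJ _ _ _ _ (hg h)) (fun a a' b b' x c => ho _ _ _ _ x c) E hgE
    (fun a b T => hmark _ (hS _ _) T)⟩

/-! ### Numbers of distinct rows -/

section Rows

open Classical

variable {N : ℕ} (G : SimpleGraph (Fin N))

/-- The row of `x` in the adjacency matrix, restricted to the columns in `T`. -/
noncomputable def rowOn (T : Finset (Fin N)) (x : Fin N) : Finset (Fin N) :=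
  T.filter (G.Adj x)

/-- The number of distinct rows of the submatrix with rows `B` and columns `T`. -/
noncomputable def numRows (B T : Finset (Fin N)) : ℕ := (B.image (rowOn G T)).card

theorem rowOn_eq_iff {T : Finset (Fin N)} {x y : Fin N} :
    rowOn G T x = rowOn G T y ↔ ∀ z ∈ T, (G.Adj x z ↔ G.Adj y z) := by
  simp only [rowOn, Finset.ext_iff, Finset.mem_filter, and_congr_right_iff]

theorem numRows_le_of_determined {B T T' : Finset (Fin N)}
    (h : ∀ x ∈ B, ∀ y ∈ B, rowOn G T x = rowOn G T y → rowOn G T' x = rowOn G T' y) :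
    numRows G B T' ≤ numRows G B T := by
  have hsel : ∀ r ∈ B.image (rowOn G T'), ∃ x ∈ B, rowOn G T' x = r := fun r hr =>
    Finset.mem_image.mp hr
  rcases B.eq_empty_or_nonempty with rfl | ⟨x₀, -⟩
  · simp [numRows]
  have : Nonempty (Fin N) := ⟨x₀⟩
  choose! s hsB hs using hsel
  refine Finset.card_le_card_of_injOn (fun r => rowOn G T (s r))
    (fun r hr => Finset.mem_image_of_mem _ (hsB r hr)) ?_
  intro r hr r' hr' hrr
  rw [← hs r hr, ← hs r' hr']
  exact h _ (hsB r hr) _ (hsB r' hr') hrr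

theorem numRows_le_two_pow (B T : Finset (Fin N)) : numRows G B T ≤ 2 ^ T.card := by
  rw [← Finset.card_powerset]
  refine Finset.card_le_card fun r hr => ?_
  obtain ⟨x, -, rfl⟩ := Finset.mem_image.mp hr
  exact Finset.mem_powerset.mpr (Finset.filter_subset _ _)

theorem numRows_union_le (B T T' : Finset (Fin N)) :
    numRows G B (T ∪ T') ≤ numRows G B T * numRows G B T' := by
  rw [numRows, numRows, numRows, ← Finset.card_product]
  have hsub : B.image (rowOn G (T ∪ T')) ⊆
      (B.image (rowOn G T) ×ˢ B.image (rowOn G T')).image fun p => p.1 ∪ p.2 := by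
    intro r hr
    obtain ⟨x, hx, rfl⟩ := Finset.mem_image.mp hr
    refine Finset.mem_image.mpr ⟨(rowOn G T x, rowOn G T' x), Finset.mem_product.mpr
      ⟨Finset.mem_image_of_mem _ hx, Finset.mem_image_of_mem _ hx⟩, ?_⟩
    exact (Finset.filter_union _ _ _).symm
  exact (Finset.card_le_card hsub).trans Finset.card_image_le

/-- The `i`-th block of `L` consecutive vertices. -/
def block (N L i : ℕ) : Finset (Fin N) := Finset.univ.filter fun x => (x : ℕ) / L = i

theorem mem_block {N L i : ℕ} {x : Fin N} : x ∈ block N L i ↔ (x : ℕ) / L = i := by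
  simp [block]

theorem card_block_le {N L : ℕ} (hL : 0 < L) (i : ℕ) : (block N L i).card ≤ L := by
  have := Finset.card_le_card_of_injOn (s := block N L i) (t := Finset.range L)
    (fun x => (x : ℕ) % L) (fun x _ => Finset.mem_coe.mpr (Finset.mem_range.mpr (Nat.mod_lt _ hL)))
    (by
      intro x hx y hy hxy
      have hx' := mem_block.mp hx
      have hy' := mem_block.mp hy
      simp only at hxy
      have h1 := Nat.div_add_mod (x : ℕ) L
      have h2 := Nat.div_add_mod (y : ℕ) L
      rw [hx', hxy] at h1
      rw [hy'] at h2
      exact Fin.ext (h1.symm.trans h2))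
  simpa using this

theorem card_block {N L i : ℕ} (hL : 0 < L) (hi : i < N / L) : (block N L i).card = L := by
  refine le_antisymm (card_block_le hL i) ?_
  have hN : L * (i + 1) ≤ N :=
    (Nat.mul_le_mul_left _ hi).trans (Nat.mul_div_le N L)
  have hlt : ∀ t : Fin L, L * i + t < N := fun t => by
    have := t.2
    rw [mul_add] at hN
    omega
  have := Finset.card_le_card_of_injOn (s := (Finset.univ : Finset (Fin L))) (t := block N L i)
    (fun t => ⟨L * i + t, hlt t⟩) (fun t _ => by
      simp [mem_block, Nat.mul_add_div hL, Nat.div_eq_of_lt t.2])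
    (fun t _ t' _ h => by simpa [Fin.ext_iff] using h)
  simpa using this

/-- The blocks of columns having more than `r` distinct rows in the `i`-th block of rows. -/
noncomputable def richCols (L r i : ℕ) : Finset ℕ :=
  (Finset.range (N / L + 1)).filter fun j => r < numRows G (block N L i) (block N L j)

/-- The columns in blocks before the `j`-th one, outside of the rich blocks. -/
noncomputable def prefixCols (L r i j : ℕ) : Finset (Fin N) :=
  Finset.univ.filter fun z => (z : ℕ) / L < j ∧ (z : ℕ) / L ∉ richCols G L r i

/-- The blocks of columns that are not rich and tell apart rows agreeing on the prefix. -/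
noncomputable def splitCols (L r i : ℕ) : Finset ℕ :=
  (Finset.range (N / L + 1)).filter fun j => j ∉ richCols G L r i ∧
    ∃ x ∈ block N L i, ∃ y ∈ block N L i, (∀ z ∈ prefixCols G L r i j, (G.Adj x z ↔ G.Adj y z)) ∧
      ∃ c ∈ block N L j, G.Adj x c ∧ ¬ G.Adj y c

theorem exists_adj_not_adj_of_rowOn_ne {B T T' : Finset (Fin N)}
    (h : ∃ x ∈ B, ∃ y ∈ B, rowOn G T x = rowOn G T y ∧ rowOn G T' x ≠ rowOn G T' y) :
    ∃ x ∈ B, ∃ y ∈ B, (∀ z ∈ T, (G.Adj x z ↔ G.Adj y z)) ∧ ∃ c ∈ T', G.Adj x c ∧ ¬ G.Adj y c := by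
  obtain ⟨x, hx, y, hy, hT, hT'⟩ := h
  rw [rowOn_eq_iff] at hT
  rw [Ne, rowOn_eq_iff] at hT'
  push Not at hT'
  obtain ⟨c, hc, h | h⟩ := hT'
  · exact ⟨x, hx, y, hy, hT, c, hc, h⟩
  · exact ⟨y, hy, x, hx, fun z hz => (hT z hz).symm, c, hc, h.2, h.1⟩

/-- As `j` grows, rich blocks do not enter the prefix, and a block neither rich nor split does not
refine the partition into equal rows. A split block is not rich, so it multiplies the number of rows
by at most `r`. -/
theorem numRows_prefixCols_le {L r : ℕ} (hr : 1 ≤ r) (i j : ℕ) (hj : j ≤ N / L + 1) :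
    numRows G (block N L i) (prefixCols G L r i j) ≤
      r ^ ((splitCols G L r i).filter (· < j)).card := by
  induction j with
  | zero =>
    have : prefixCols G L r i 0 = ∅ := by simp [prefixCols]
    rw [this]
    refine (numRows_le_two_pow G _ _).trans ?_
    simp
  | succ j ih =>
    have ih := ih (by omega)
    have hmono : ((splitCols G L r i).filter (· < j)).card ≤
        ((splitCols G L r i).filter (· < j + 1)).card :=
      Finset.card_le_card fun x hx => by
        simp only [Finset.mem_filter] at hx ⊢
        exact ⟨hx.1, by omega⟩
    by_cases hrich : j ∈ richCols G L r i
    · have : prefixCols G L r i (j + 1) = prefixCols G L r i j := by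
        ext z
        simp only [prefixCols, Finset.mem_filter, Finset.mem_univ, true_and]
        constructor
        · rintro ⟨h1, h2⟩
          exact ⟨lt_of_le_of_ne (by omega) (fun h => h2 (h ▸ hrich)), h2⟩
        · rintro ⟨h1, h2⟩
          exact ⟨by omega, h2⟩
      rw [this]
      exact ih.trans (Nat.pow_le_pow_right hr hmono)
    have hunion : prefixCols G L r i (j + 1) = prefixCols G L r i j ∪ block N L j := by
      ext z
      simp only [prefixCols, Finset.mem_filter, Finset.mem_univ, true_and, Finset.mem_union,
        mem_block]
      constructor
      · rintro ⟨h1, h2⟩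
        rcases Nat.lt_succ_iff_lt_or_eq.mp h1 with h | h
        · exact Or.inl ⟨h, h2⟩
        · exact Or.inr h
      · rintro (⟨h1, h2⟩ | h)
        · exact ⟨by omega, h2⟩
        · exact ⟨by omega, h ▸ hrich⟩
    by_cases hsplit : j ∈ splitCols G L r i
    · have hcard : ((splitCols G L r i).filter (· < j)).card + 1 ≤
          ((splitCols G L r i).filter (· < j + 1)).card := by
        rw [← Finset.card_insert_of_notMem (a := j) (by simp)]
        refine Finset.card_le_card fun x hx => ?_
        simp only [Finset.mem_insert, Finset.mem_filter] at hx ⊢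
        rcases hx with rfl | hx
        · exact ⟨hsplit, by omega⟩
        · exact ⟨hx.1, by omega⟩
      have hpoor : numRows G (block N L i) (block N L j) ≤ r := by
        by_contra h
        exact hrich (Finset.mem_filter.mpr ⟨Finset.mem_range.mpr hj, by omega⟩)
      calc _ ≤ numRows G (block N L i) (prefixCols G L r i j) *
              numRows G (block N L i) (block N L j) := by
            rw [hunion]; exact numRows_union_le G _ _ _
        _ ≤ _ := Nat.mul_le_mul ih hpoor
        _ = r ^ (((splitCols G L r i).filter (· < j)).card + 1) := (pow_succ _ _).symm
        _ ≤ _ := Nat.pow_le_pow_right hr hcard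
    · refine le_trans ?_ (ih.trans (Nat.pow_le_pow_right hr hmono))
      refine numRows_le_of_determined G fun x hx y hy hxy => ?_
      by_contra hne
      apply hsplit
      refine Finset.mem_filter.mpr ⟨Finset.mem_range.mpr hj, hrich,
        exists_adj_not_adj_of_rowOn_ne G ⟨x, hx, y, hy, hxy, fun hb => hne ?_⟩⟩
      rw [rowOn_eq_iff] at hxy hb ⊢
      rw [hunion]
      intro z hz
      rcases Finset.mem_union.mp hz with h | h
      · exact hxy z h
      · exact hb z h

/-- The columns telling apart two rows. -/
noncomputable def diffCols (x y : Fin N) : Finset (Fin N) :=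
  Finset.univ.filter fun z => ¬ (G.Adj x z ↔ G.Adj y z)

/-- There are more rows in the block than row patterns outside the rich blocks, so two rows can
differ only inside at most `m₁` rich blocks of at most `L` columns each. -/
theorem exists_near_twins_in_block {L r m₁ m₂ i : ℕ} (hr : 1 ≤ r) (hL : r ^ m₂ < L)
    (hi : i < N / L) (h₁ : (richCols G L r i).card ≤ m₁) (h₂ : (splitCols G L r i).card ≤ m₂) :
    ∃ x ∈ block N L i, ∃ y ∈ block N L i, x ≠ y ∧ (diffCols G x y).card ≤ m₁ * L := by
  have hL0 : 0 < L := by omega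
  have hle := numRows_prefixCols_le G (L := L) hr i (N / L + 1) le_rfl
  have hlt : ((block N L i).image (rowOn G (prefixCols G L r i (N / L + 1)))).card <
      (block N L i).card := by
    rw [card_block hL0 hi]
    refine lt_of_le_of_lt (hle.trans (Nat.pow_le_pow_right hr ?_)) hL
    exact (Finset.card_filter_le _ _).trans h₂
  obtain ⟨x, hx, y, hy, hxy, hrow⟩ := Finset.exists_ne_map_eq_of_card_lt_of_maps_to hlt
    (fun a ha => Finset.mem_image_of_mem _ ha)
  rw [rowOn_eq_iff] at hrow
  refine ⟨x, hx, y, hy, hxy, ?_⟩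
  have hsub : diffCols G x y ⊆ (richCols G L r i).biUnion (block N L) := by
    intro z hz
    have hz' := (Finset.mem_filter.mp hz).2
    refine Finset.mem_biUnion.mpr ⟨(z : ℕ) / L, ?_, mem_block.mpr rfl⟩
    by_contra hn
    refine hz' (hrow z (Finset.mem_filter.mpr ⟨Finset.mem_univ _, ?_, hn⟩))
    exact Nat.lt_succ_of_le (Nat.div_le_div_right z.2.le)
  exact ((Finset.card_le_card hsub).trans (Finset.card_biUnion_le_card_mul _ _ L
    fun j _ => card_block_le hL0 j)).trans (Nat.mul_le_mul_right _ h₁)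

end Rows

/-- In a sparse matrix, few rows have many entries. -/
theorem card_heavy_rows_le {k c : ℕ} (hc : ∀ (n : ℕ) (S : Finset (ℕ × ℕ)),
      S ⊆ Finset.range n ×ˢ Finset.range n → ¬ HasGrid (S : Set (ℕ × ℕ)) k → S.card ≤ c * n)
    (q : ℕ) (R : ℕ → Finset ℕ) (hR : ∀ i, R i ⊆ Finset.range (q + 1))
    (hgrid : ¬ HasGrid {p | p.2 ∈ R p.1} k) :
    4 * ((Finset.range q).filter fun i => 8 * (c + 1) ≤ (R i).card).card ≤ q := by
  classical
  set A := (Finset.range q).filter fun i => 8 * (c + 1) ≤ (R i).card with hA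
  let S : Finset (ℕ × ℕ) := A.sigma R |>.map (Equiv.sigmaEquivProd ℕ ℕ).toEmbedding
  have hmem : ∀ p : ℕ × ℕ, p ∈ S ↔ p.1 ∈ A ∧ p.2 ∈ R p.1 := by
    intro p
    simp only [S, Finset.mem_map_equiv, Finset.mem_sigma]
    rfl
  have h1 : S.card = ∑ i ∈ A, (R i).card := by
    rw [Finset.card_map, Finset.card_sigma]
  have h2 : A.card * (8 * (c + 1)) ≤ S.card := by
    rw [h1, ← smul_eq_mul]
    exact Finset.card_nsmul_le_sum _ _ _ fun i hi => (Finset.mem_filter.mp hi).2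
  have h3 : S.card ≤ c * (q + 1) := by
    refine hc (q + 1) S (fun p hp => ?_) (fun h => hgrid (h.mono fun p hp => ?_))
    · obtain ⟨hp1, hp2⟩ := (hmem p).mp hp
      have := Finset.mem_range.mp (Finset.mem_filter.mp hp1).1
      exact Finset.mem_product.mpr ⟨Finset.mem_range.mpr (by omega), hR _ hp2⟩
    · exact ((hmem p).mp hp).2
  rcases Nat.eq_zero_or_pos q with rfl | hq
  · simp [hA]
  -- Since `q + 1 ≤ 2 * q`, more than a quarter of the rows with `8 * (c + 1)` entries would exceed
  -- the bound `c * (q + 1)`.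
  · by_contra hcon
    push Not at hcon
    nlinarith

/-- In a graph without a universal grid, at least half of the blocks contain near twins. -/
theorem exists_near_twins (n : ℕ) : ∃ L D : ℕ, 0 < L ∧ ∀ (N : ℕ) (G : SimpleGraph (Fin N)),
    (∀ o, ¬ HasUniversalGrid G o n) → ∃ A ⊆ Finset.range (N / L), N / L ≤ 2 * A.card ∧
      ∀ i ∈ A, ∃ x ∈ block N L i, ∃ y ∈ block N L i, x ≠ y ∧ (diffCols G x y).card ≤ D := by
  classical
  obtain ⟨k₁, hk₁⟩ := exists_hasUniversalGrid_of_marks n 0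
  obtain ⟨c₁, hc₁⟩ := marcus_tardos k₁
  set m₁ := 8 * (c₁ + 1) with hm₁
  obtain ⟨k₂, hk₂⟩ := exists_hasUniversalGrid_of_marks n m₁
  obtain ⟨c₂, hc₂⟩ := marcus_tardos k₂
  set m₂ := 8 * (c₂ + 1) with hm₂
  -- More than `2 ^ n ^ 2` distinct rows guarantee a distinguishable pair that agrees on `n ^ 2`
  -- prescribed columns.
  set r := 2 ^ n ^ 2 with hr
  set L := r ^ m₂ + 1 with hL
  have hr1 : 1 ≤ r := Nat.one_le_two_pow
  refine ⟨L, m₁ * L, by omega, fun N G hG => ?_⟩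
  set R₁ : ℕ → Finset ℕ := fun i => richCols G L r i with hR₁
  -- Split blocks are marked only in rows with few rich blocks, because the rich blocks act as
  -- exceptional sets, whose size must be bounded by `m₁`. The other rows are discarded anyway.
  set R₂ : ℕ → Finset ℕ := fun i => if (richCols G L r i).card ≤ m₁ then splitCols G L r i else ∅
    with hR₂
  have hgrid₁ : ¬ HasGrid {p | p.2 ∈ R₁ p.1} k₁ := by
    intro h
    refine absurd (hk₁ N G L L _ (fun _ => ∅) (by simp) (fun p hp T hT _ => ?_) h)
      (fun ⟨o, ho⟩ => hG o ho)
    have hp' : r < numRows G (block N L p.1) (block N L p.2) :=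
      (Finset.mem_filter.mp (show p.2 ∈ richCols G L r p.1 from hp)).2
    have hex : ∃ x ∈ block N L p.1, ∃ y ∈ block N L p.1, rowOn G T x = rowOn G T y ∧
        rowOn G (block N L p.2) x ≠ rowOn G (block N L p.2) y := by
      by_contra hcon
      push Not at hcon
      have h1 := numRows_le_of_determined G hcon
      have h2 := numRows_le_two_pow G (block N L p.1) T
      have h3 : 2 ^ T.card ≤ r := Nat.pow_le_pow_right (by norm_num) hT
      omega
    obtain ⟨x, hx, y, hy, hT', c, hc, h1, h2⟩ := exists_adj_not_adj_of_rowOn_ne G hex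
    exact ⟨x, y, c, mem_block.mp hx, mem_block.mp hy, mem_block.mp hc, h1, h2, hT'⟩
  -- The prescribed columns lie in the prefix, on which the pair witnessing a split agrees.
  have hgrid₂ : ¬ HasGrid {p | p.2 ∈ R₂ p.1} k₂ := by
    intro h
    refine absurd (hk₂ N G L L _
      (fun i => if (richCols G L r i).card ≤ m₁ then richCols G L r i else ∅)
      (fun i => by split_ifs with h <;> simp [h]) (fun p hp T _ hT => ?_) h)
      (fun ⟨o, ho⟩ => hG o ho)
    by_cases hcard : (richCols G L r p.1).card ≤ m₁
    · simp only [hR₂, Set.mem_ofPred_eq, hcard, if_true] at hp hT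
      obtain ⟨x, hx, y, hy, hxy, c, hc, h1, h2⟩ := (Finset.mem_filter.mp hp).2.2
      exact ⟨x, y, c, mem_block.mp hx, mem_block.mp hy, mem_block.mp hc, h1, h2, fun z hz =>
        hxy z (Finset.mem_filter.mpr ⟨Finset.mem_univ _, hT z hz⟩)⟩
    · simp [hR₂, hcard] at hp
  have h₁ := card_heavy_rows_le hc₁ (N / L) R₁ (fun i => Finset.filter_subset _ _) hgrid₁
  have h₂ := card_heavy_rows_le hc₂ (N / L) R₂ (fun i => by
    simp only [hR₂]
    split_ifs
    · exact Finset.filter_subset _ _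
    · simp) hgrid₂
  set B₁ := (Finset.range (N / L)).filter fun i => 8 * (c₁ + 1) ≤ (R₁ i).card
  set B₂ := (Finset.range (N / L)).filter fun i => 8 * (c₂ + 1) ≤ (R₂ i).card
  refine ⟨Finset.range (N / L) \ (B₁ ∪ B₂), Finset.sdiff_subset, ?_, ?_⟩
  · have h3 := Finset.le_card_sdiff (B₁ ∪ B₂) (Finset.range (N / L))
    have h4 := Finset.card_union_le B₁ B₂
    rw [Finset.card_range] at h3
    omega
  · intro i hi
    obtain ⟨hi1, hi2⟩ := Finset.mem_sdiff.mp hi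
    rw [Finset.mem_union, not_or] at hi2
    have hn1 : (R₁ i).card ≤ m₁ := by
      by_contra h
      exact hi2.1 (Finset.mem_filter.mpr ⟨hi1, by omega⟩)
    have hn2 : (R₂ i).card ≤ m₂ := by
      by_contra h
      exact hi2.2 (Finset.mem_filter.mpr ⟨hi1, by omega⟩)
    have hn3 : (splitCols G L r i).card ≤ m₂ := by
      simpa only [hR₂, show (richCols G L r i).card ≤ m₁ from hn1, if_true] using hn2
    exact exists_near_twins_in_block G hr1 (by omega) (Finset.mem_range.mp hi1) hn1 hn3

end OrderedGraphClass

namespace OrderedGraphClass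

/-! ### Counting graphs without universal grids -/

/-- A description of the part of the graph `G` involving the vertices `u` with `part u ≠ none`:
such a vertex has a kept partner in its block, and the set `T` records where the two differ. -/
def IsCode {N L : ℕ} (G : SimpleGraph (Fin N)) (part : Fin N → Option (Fin L))
    (T : Finset (ℕ × ℕ)) : Prop :=
  ∀ y o, part y = some o → ∃ x : Fin N, (x : ℕ) = L * (y / L) + o ∧ part x = none ∧
    ∀ v : Fin N, (G.Adj y v ↔ (G.Adj x v ↔ ((y : ℕ) / L, (v : ℕ)) ∉ T))

/-- The code recovers the rows of deleted vertices on kept columns from their partners; by symmetry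
it then recovers all remaining entries. -/
theorem IsCode.eq {N L : ℕ} {G H : SimpleGraph (Fin N)} {part : Fin N → Option (Fin L)}
    {T : Finset (ℕ × ℕ)} (hG : IsCode G part T) (hH : IsCode H part T)
    (h : ∀ u v, part u = none → part v = none → (G.Adj u v ↔ H.Adj u v)) : G = H := by
  have step : ∀ v, (∀ u, part u = none → (G.Adj u v ↔ H.Adj u v)) →
      ∀ u, (G.Adj u v ↔ H.Adj u v) := by
    intro v hv u
    rcases hu : part u with _ | o
    · exact hv u hu
    · obtain ⟨x, hx, hxn, hxv⟩ := hG u o hu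
      obtain ⟨x', hx', -, hxv'⟩ := hH u o hu
      obtain rfl : x = x' := Fin.ext (hx.trans hx'.symm)
      rw [hxv, hxv', hv x hxn]
  ext u v
  refine step v (fun u hu => ?_) u
  rw [G.adj_comm, H.adj_comm]
  exact step u (fun w hw => h w u hw hu) v

/-- One near twin is deleted from `d` of the blocks. The differences are marks with columns as
blocks of length 1 and with the differing columns themselves as exceptional sets: outside these the
twins agree, so a `k`-grid of differences would give a universal grid. -/
theorem exists_isCode {n L D k N d : ℕ} (hL : 0 < L) {G : SimpleGraph (Fin N)}
    (hk : ∀ (S : Set (ℕ × ℕ)) (E : ℕ → Finset ℕ), (∀ i, (E i).card ≤ D) →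
      (∀ p ∈ S, ∀ T : Finset (Fin N), T.card ≤ n ^ 2 →
        (∀ z ∈ T, (z : ℕ) / 1 < p.2 ∧ (z : ℕ) / 1 ∉ E p.1) →
        ∃ x y c : Fin N, x / L = p.1 ∧ y / L = p.1 ∧ c / 1 = p.2 ∧ G.Adj x c ∧
          ¬ G.Adj y c ∧ ∀ z ∈ T, (G.Adj x z ↔ G.Adj y z)) →
      HasGrid S k → ∃ o, HasUniversalGrid G o n)
    (hG : ∀ o, ¬ HasUniversalGrid G o n) {A : Finset ℕ} (hA : A ⊆ Finset.range (N / L))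
    (hd : d ≤ A.card)
    (hAxy : ∀ i ∈ A, ∃ x ∈ block N L i, ∃ y ∈ block N L i, x ≠ y ∧ (diffCols G x y).card ≤ D) :
    ∃ (part : Fin N → Option (Fin L)) (T : Finset (ℕ × ℕ)), T ∈ gridFree k N ∧
      (Finset.univ.filter fun u => part u = none).card = N - d ∧ IsCode G part T := by
  classical
  obtain ⟨A, hAA, rfl⟩ := Finset.exists_subset_card_eq hd
  replace hAxy := fun i hi => hAxy i (hAA hi)
  replace hA := hAA.trans hA
  rcases Nat.eq_zero_or_pos N with rfl | hN
  · have hA0 : A = ∅ := by simpa using hA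
    subst hA0
    have hgrid : ¬ HasGrid (∅ : Set (ℕ × ℕ)) k := fun h => by
      obtain ⟨o, ho⟩ := hk ∅ (fun _ => ∅) (by simp) (by simp) h
      exact hG o ho
    exact ⟨fun _ => none, ∅, Finset.mem_filter.mpr ⟨by simp, by simpa using hgrid⟩, by simp,
      fun y => y.elim0⟩
  have : Nonempty (Fin N) := ⟨⟨0, hN⟩⟩
  choose! x hx y hy hxy hD using hAxy
  simp only [mem_block] at hx hy
  let part : Fin N → Option (Fin L) := fun u =>
    if (u : ℕ) / L ∈ A ∧ y (u / L) = u then some ⟨x (u / L) % L, Nat.mod_lt _ hL⟩ else none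
  let T : Finset (ℕ × ℕ) := (A ×ˢ Finset.range N).filter fun p =>
    ∃ h : p.2 < N, (⟨p.2, h⟩ : Fin N) ∈ diffCols G (x p.1) (y p.1)
  have hdiff : ∀ i z, z ∈ diffCols G (x i) (y i) ↔ ¬ (G.Adj (x i) z ↔ G.Adj (y i) z) := by
    intro i z
    simp [diffCols]
  have hnone : ∀ u, part u = none ↔ ¬ ((u : ℕ) / L ∈ A ∧ y (u / L) = u) := by
    intro u
    simp only [part]
    split_ifs with h <;> simp [h]
  refine ⟨part, T, Finset.mem_filter.mpr ⟨Finset.mem_powerset.mpr fun p hp => ?_, fun hgrid => ?_⟩,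
    ?_, ?_⟩
  · obtain ⟨h1, h2⟩ := Finset.mem_product.mp (Finset.mem_filter.mp hp).1
    have := Finset.mem_range.mp (hA h1)
    have := Nat.div_le_self N L
    exact Finset.mem_product.mpr ⟨Finset.mem_range.mpr (by omega), h2⟩
  · refine absurd (hk _ (fun i => if i ∈ A then (diffCols G (x i) (y i)).image Fin.val else ∅)
      (fun i => ?_) (fun p hp U _ hU => ?_) hgrid) (fun ⟨o, ho⟩ => hG o ho)
    · split_ifs with h
      · exact Finset.card_image_le.trans (hD i h)
      · simp
    · obtain ⟨h1, hpN, h2⟩ := Finset.mem_filter.mp (Finset.mem_coe.mp hp)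
      have hpA := (Finset.mem_product.mp h1).1
      have hagree : ∀ z ∈ U, (G.Adj (x p.1) z ↔ G.Adj (y p.1) z) := by
        intro z hz
        have := (hU z hz).2
        rw [if_pos hpA, Nat.div_one] at this
        by_contra hne
        exact this (Finset.mem_image_of_mem _ ((hdiff _ _).mpr hne))
      rw [hdiff] at h2
      by_cases hadj : G.Adj (x p.1) ⟨p.2, hpN⟩
      · exact ⟨x p.1, y p.1, ⟨p.2, hpN⟩, hx _ hpA, hy _ hpA, Nat.div_one _, hadj,
          fun h => h2 (iff_of_true hadj h), hagree⟩
      · refine ⟨y p.1, x p.1, ⟨p.2, hpN⟩, hy _ hpA, hx _ hpA, Nat.div_one _, ?_, hadj,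
          fun z hz => (hagree z hz).symm⟩
        by_contra h
        exact h2 (iff_of_false hadj h)
  · have himage : (Finset.univ.filter fun u => part u = none) = Finset.univ \ A.image y := by
      ext u
      simp only [Finset.mem_filter, Finset.mem_univ, true_and, Finset.mem_sdiff, hnone,
        Finset.mem_image, not_iff_not]
      constructor
      · exact fun h => ⟨_, h.1, h.2⟩
      · rintro ⟨i, hi, rfl⟩
        rw [hy i hi]
        exact ⟨hi, rfl⟩
    rw [himage, Finset.card_sdiff_of_subset (Finset.subset_univ _), Finset.card_univ,
      Fintype.card_fin, Finset.card_image_of_injOn]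
    intro i hi j hj hij
    rw [← hy i hi, ← hy j hj, hij]
  · intro u o hu
    have hcond : (u : ℕ) / L ∈ A ∧ y (u / L) = u := by
      by_contra h
      rw [(hnone u).mpr h] at hu
      exact absurd hu (by simp)
    have ho : o = ⟨x (u / L) % L, Nat.mod_lt _ hL⟩ := by
      simp only [part, if_pos hcond, Option.some.injEq] at hu
      exact hu.symm
    refine ⟨x (u / L), ?_, ?_, fun v => ?_⟩
    · have := Nat.div_add_mod (x (u / L) : ℕ) L
      rw [hx _ hcond.1] at this
      rw [ho]
      exact this.symm
    · rw [hnone, hx _ hcond.1, hcond.2]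
      exact fun h => hxy _ hcond.1 (h.2.symm.trans hcond.2.symm)
    · have hT : ((u : ℕ) / L, (v : ℕ)) ∈ T ↔ v ∈ diffCols G (x (u / L)) (y (u / L)) := by
        simp [T, hcond.1]
      rw [hT, hdiff, hcond.2]
      tauto

theorem ncard_simpleGraph_le (N : ℕ) (S : Set (SimpleGraph (Fin N))) :
    S.ncard ≤ 2 ^ (N * N) := by
  classical
  have h1 : S.ncard ≤ Fintype.card (SimpleGraph (Fin N)) := by
    rw [← Nat.card_eq_fintype_card, ← Set.ncard_univ]
    exact Set.ncard_le_ncard (Set.subset_univ _)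
  refine h1.trans ?_
  have h2 := Fintype.card_le_of_injective (β := Finset (Fin N × Fin N))
    (fun G : SimpleGraph (Fin N) => Finset.univ.filter fun p : Fin N × Fin N => G.Adj p.1 p.2)
    (fun G H h => by
      ext u v
      simpa using congrArg (fun S => (u, v) ∈ S) h)
  simpa using h2

theorem growth_le_of_codes {C : OrderedGraphClass} (hC : C.IsHereditary) {k N L d : ℕ}
    (h : ∀ G ∈ C N, ∃ (part : Fin N → Option (Fin L)) (T : Finset (ℕ × ℕ)), T ∈ gridFree k N ∧
      (Finset.univ.filter fun u => part u = none).card = N - d ∧ IsCode G part T) :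
    C.growth N ≤ (L + 1) ^ N * ((gridFree k N).card * C.growth (N - d)) := by
  classical
  choose! part T hT hcard hcode using h
  let e : (Fin N → Option (Fin L)) → Fin (N - d) → Fin N := fun p =>
    if h : (Finset.univ.filter fun u => p u = none).card = N - d then
      (Finset.univ.filter fun u => p u = none).orderEmbOfFin h
    -- Never reached for graphs in the class; it only makes `e` a total function of the partition.
    else fun i => ⟨i, by omega⟩
  have he : ∀ G (hG : G ∈ C N), e (part G) =
      (Finset.univ.filter fun u => part G u = none).orderEmbOfFin (hcard G hG) := by
    intro G hG
    simp only [e, dif_pos (hcard G hG)]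
  have hfin : ∀ n, (C n).Finite := fun n => Set.toFinite _
  let W : Finset ((Fin N → Option (Fin L)) × Finset (ℕ × ℕ) × SimpleGraph (Fin (N - d))) :=
    Finset.univ ×ˢ gridFree k N ×ˢ (hfin (N - d)).toFinset
  have hW : W.card = (L + 1) ^ N * ((gridFree k N).card * C.growth (N - d)) := by
    simp only [W, Finset.card_product, growth, Set.ncard_eq_toFinset_card _ (hfin _)]
    simp
  rw [← hW, growth, Set.ncard_eq_toFinset_card _ (hfin N)]
  refine Finset.card_le_card_of_injOn (fun G => (part G, T G, G.comap (e (part G)))) ?_ ?_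
  · intro G hG
    have hG' : G ∈ C N := by simpa using hG
    simp only [W, Finset.coe_product, Set.mem_prod, Finset.coe_univ, Set.mem_univ, true_and,
      Finset.mem_coe, Set.Finite.mem_toFinset]
    refine ⟨hT G hG', ?_⟩
    rw [he G hG']
    exact hC _ G hG'
  · intro G hG H hH hGH
    have hG' : G ∈ C N := by simpa using hG
    have hH' : H ∈ C N := by simpa using hH
    simp only [Prod.mk.injEq] at hGH
    obtain ⟨h1, h2, h3⟩ := hGH
    refine IsCode.eq (hcode G hG') (by rw [h1, h2]; exact hcode H hH') fun u v hu hv => ?_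
    have hrange : ∀ u, part G u = none → ∃ i, e (part G) i = u := by
      intro u hu
      have : u ∈ Set.range ((Finset.univ.filter fun u => part G u = none).orderEmbOfFin
          (hcard G hG')) := by
        rw [Finset.range_orderEmbOfFin]
        simpa using hu
      rwa [← he G hG'] at this
    obtain ⟨i, rfl⟩ := hrange u hu
    obtain ⟨j, rfl⟩ := hrange v hv
    rw [← h1] at h3
    have := congrArg (fun K : SimpleGraph (Fin (N - d)) => K.Adj i j) h3
    simpa using this

/-- A hereditary class without large universal grids has growth `2 ^ O(n)`. -/
theorem hasExpGrowth_of_no_universalGrid {C : OrderedGraphClass} (hC : C.IsHereditary) (n : ℕ)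
    (h : ∀ (N : ℕ) (G : SimpleGraph (Fin N)) (o : Bool), G ∈ C N → ¬ HasUniversalGrid G o n) :
    C.HasExpGrowth := by
  obtain ⟨L, D, hL, hLD⟩ := exists_near_twins n
  obtain ⟨k, hk⟩ := exists_hasUniversalGrid_of_marks n D
  obtain ⟨c, hc⟩ := card_gridFree_le k
  -- Restoring the twins costs `2 ^ ((L + c) * N)`, and `N ≤ 4 * L * d` turns this into `4 * L * (L
  -- + c)` for each of the `d` deleted vertices. The summand `L` covers `N < L` through `N * N ≤ L *
  -- N`.
  refine ⟨4 * L * (L + c) + L, Filter.Eventually.of_forall fun N => ?_⟩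
  induction N using Nat.strong_induction_on with
  | _ N ih =>
    rcases lt_or_ge N L with hN | hN
    · refine (ncard_simpleGraph_le N _).trans (Nat.pow_le_pow_right (by norm_num) ?_)
      exact Nat.mul_le_mul_right _ (by omega)
    set q := N / L with hq
    have hq1 : 1 ≤ q := (Nat.one_le_div_iff hL).mpr hN
    have hNq : N < L * q + L := Nat.lt_mul_div_succ N hL
    set d := (q + 1) / 2 with hd
    have hdN : N ≤ 4 * L * d := by
      have h1 : q ≤ 2 * d := by omega
      have h2 : L * q ≤ L * (2 * d) := Nat.mul_le_mul_left _ h1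
      have h3 : L * 1 ≤ L * q := Nat.mul_le_mul_left _ hq1
      linarith
    have hd' : d ≤ N := by
      have : q ≤ N := Nat.div_le_self N L
      omega
    have hstep : C.growth N ≤ (L + 1) ^ N * ((gridFree k N).card * C.growth (N - d)) := by
      refine growth_le_of_codes hC fun G hG => ?_
      obtain ⟨A, hA, hA2, hAxy⟩ := hLD N G fun o => h N G o hG
      exact exists_isCode hL (fun S E => hk N G L 1 S E) (fun o => h N G o hG) hA (by omega) hAxy
    refine hstep.trans ?_
    have h1 : (L + 1) ^ N ≤ 2 ^ (L * N) := by
      rw [pow_mul]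
      exact Nat.pow_le_pow_left (Nat.lt_two_pow_self) N
    calc _ ≤ 2 ^ (L * N) * (2 ^ (c * N) * 2 ^ ((4 * L * (L + c) + L) * (N - d))) :=
          Nat.mul_le_mul h1 (Nat.mul_le_mul (hc N) (ih _ (by omega)))
      _ = 2 ^ ((L + c) * N + (4 * L * (L + c) + L) * (N - d)) := by
          rw [← pow_add, ← pow_add]; ring_nf
      _ ≤ _ := by
          refine Nat.pow_le_pow_right (by norm_num) ?_
          obtain ⟨m, hm⟩ := Nat.exists_eq_add_of_le hd'
          have h2 : N - d = m := by omega
          rw [h2]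
          have h3 : (L + c) * N ≤ (L + c) * (4 * L * d) := Nat.mul_le_mul_left _ hdN
          have h4 : (4 * L * (L + c) + L) * N = (4 * L * (L + c) + L) * (d + m) := by rw [hm]
          have h5 : 0 ≤ L * d := Nat.zero_le _
          nlinarith

/-- A hereditary class with more than exponential growth contains an unavoidable class. -/
theorem exists_unavoidable_le_of_not_hasExpGrowth {C : OrderedGraphClass} (hC : C.IsHereditary)
    (h : ¬ C.HasExpGrowth) : ∃ c, unavoidable c ≤ C := by
  refine exists_unavoidable_le hC fun n => ?_
  by_contra hcon
  push Not at hcon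
  exact h (hasExpGrowth_of_no_universalGrid hC n fun N G o hG => hcon N G o hG)

end OrderedGraphClass

namespace OrderedGraphClass

/-! ### The unavoidable classes have growth `2 ^ ω(n)` -/

theorem hasSuperexpGrowth_of_factorial_le {C : OrderedGraphClass}
    (h : ∀ m, (m / 2).factorial ≤ C.growth m) : C.HasSuperexpGrowth := by
  intro K
  have h1 := FloorSemiring.tendsto_pow_div_factorial_atTop ((2 : ℝ) ^ (3 * K))
  obtain ⟨n₀, hn₀⟩ := Filter.eventually_atTop.mp (h1.eventually_lt_const zero_lt_one)
  refine Filter.eventually_atTop.mpr ⟨2 * n₀ + 2, fun m hm => ?_⟩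
  refine le_trans ?_ (h m)
  have h2 := hn₀ (m / 2) (by omega)
  rw [div_lt_one (by positivity)] at h2
  have h3 : (2 ^ (3 * K)) ^ (m / 2) ≤ (m / 2).factorial := by exact_mod_cast h2.le
  refine le_trans ?_ h3
  rw [← pow_mul]
  refine Nat.pow_le_pow_right (by norm_num) ?_
  have : m ≤ 3 * (m / 2) := by omega
  nlinarith [Nat.mul_le_mul_left K this]

/-- The inversions determine the order of the values, so `π' ∘ π⁻¹` is an increasing bijection,
hence the identity. -/
theorem permGraph_injective (n : ℕ) : Function.Injective (permGraph (n := n)) := by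
  intro π π' h
  have hadj : ∀ i j, i < j → (π j < π i ↔ π' j < π' i) := by
    intro i j hij
    have := congrArg (fun G : SimpleGraph (Fin n) => G.Adj i j) h
    simpa [permGraph, hij, hij.not_gt] using this
  have hlt : ∀ i j, π i < π j → π' i < π' j := by
    intro i j hij
    rcases lt_trichotomy i j with h1 | rfl | h1
    · have := mt (hadj i j h1).mpr hij.not_gt
      exact lt_of_le_of_ne (not_lt.mp this) (fun h => h1.ne (π'.injective h))
    · exact absurd hij (lt_irrefl _)
    · exact (hadj j i h1).mp hij
  have hmono : StrictMono fun x => π' (π.symm x) := fun x y hxy =>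
    hlt _ _ (by simpa using hxy)
  have hrange : (fun x => π' (π.symm x)) = id := by
    refine (hmono.range_inj strictMono_id).mp ?_
    rw [Set.range_id]
    exact (π'.surjective.comp π.symm.surjective).range_eq
  ext i
  have := congrFun hrange (π i)
  simp only [Equiv.symm_apply_apply, id_eq] at this
  rw [this]

theorem hasSuperexpGrowth_permClass : HasSuperexpGrowth permClass := by
  refine hasSuperexpGrowth_of_factorial_le fun m => ?_
  have : permClass.growth m = m.factorial := by
    rw [growth, permClass, ← Set.image_univ, Set.ncard_image_of_injective _ (permGraph_injective m),
      Set.ncard_univ, Nat.card_eq_fintype_card, Fintype.card_perm, Fintype.card_fin]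
  rw [this]
  exact Nat.factorial_le (Nat.div_le_self m 2)

theorem Pattern.cross_injective {n : ℕ} (s : Pattern) {σ τ : Equiv.Perm (Fin n)}
    (h : ∀ i j, s.cross σ i j ↔ s.cross τ i j) : σ = τ := by
  have hsymm : (∀ j, σ.symm j = τ.symm j) → σ = τ := fun h =>
    Equiv.symm_bijective.injective (Equiv.ext h)
  cases s with
  | eq => exact Equiv.ext fun i => ((h i _).mp rfl).symm
  | ne => exact Equiv.ext fun i => not_not.mp fun hne => (h i (τ i)).mp hne rfl
  | leL => exact hsymm fun j => eq_of_forall_le_iff fun i => h i j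
  | geL => exact hsymm fun j => eq_of_forall_ge_iff fun i => h i j
  | leR => exact Equiv.ext fun i => eq_of_forall_le_iff fun j => h i j
  | geR => exact Equiv.ext fun i => eq_of_forall_ge_iff fun j => h i j

theorem hasSuperexpGrowth_matchingClass (s : Pattern) (lam rho : Bool) :
    HasSuperexpGrowth (matchingClass s lam rho) := by
  refine hasSuperexpGrowth_of_factorial_le fun m => ?_
  set n := m / 2 with hn
  have hnm : n ≤ m := Nat.div_le_self m 2
  choose τ hτ using exists_perm_extension hnm
  -- The vertices are the first `n` on the left and the first `m - n` on the right. For odd `m`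
  -- there is an extra right vertex, which is why `σ` was extended to order `m`.
  let f : Fin m → Fin m ⊕ₗ Fin m := fun i =>
    if (i : ℕ) < n then toLex (.inl i) else toLex (.inr ⟨i - n, by omega⟩)
  have hf : StrictMono f := by
    intro i j hij
    have hij' : (i : ℕ) < j := hij
    by_cases hi : (i : ℕ) < n <;> by_cases hj : (j : ℕ) < n
    · simpa [f, hi, hj] using hij
    · simp [f, hi, hj]
    · omega
    · simp only [f, hi, hj, if_false, Sum.Lex.toLex_lt_toLex, Sum.lex_inr_inr, Fin.mk_lt_mk]
      omega
  let F : Equiv.Perm (Fin n) → SimpleGraph (Fin m) := fun σ =>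
    (matchingGraph s lam rho (τ σ)).comap (OrderEmbedding.ofStrictMono f hf)
  have hF : Function.Injective F := by
    intro σ σ' h
    refine s.cross_injective fun i j => ?_
    have hl : f (Fin.castLE hnm i) = toLex (.inl (Fin.castLE hnm i)) := by simp [f]
    have hr : f ⟨n + j, by omega⟩ = toLex (.inr (Fin.castLE hnm j)) := by
      simp [f, Fin.ext_iff]
    have := congrArg (fun G : SimpleGraph (Fin m) => G.Adj (Fin.castLE hnm i) ⟨n + j, by omega⟩) h
    simp only [F, SimpleGraph.comap_adj, OrderEmbedding.coe_ofStrictMono, hl, hr] at this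
    rw [← Pattern.cross_castLE hnm (hτ σ), ← Pattern.cross_castLE hnm (hτ σ')]
    exact iff_of_eq this
  have hsub : Set.range F ⊆ matchingClass s lam rho m := by
    rintro _ ⟨σ, rfl⟩
    exact ⟨m, τ σ, _, rfl⟩
  calc n.factorial = (Set.range F).ncard := by
        rw [← Set.image_univ, Set.ncard_image_of_injective _ hF, Set.ncard_univ,
          Nat.card_eq_fintype_card, Fintype.card_perm, Fintype.card_fin]
    _ ≤ _ := Set.ncard_le_ncard hsub (Set.toFinite _)

theorem hasSuperexpGrowth_unavoidable : ∀ c, HasSuperexpGrowth (unavoidable c)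
  | none => hasSuperexpGrowth_permClass
  | some (s, lam, rho) => hasSuperexpGrowth_matchingClass s lam rho

theorem HasSuperexpGrowth.not_hasExpGrowth {C : OrderedGraphClass} (h : C.HasSuperexpGrowth) :
    ¬ C.HasExpGrowth := by
  rintro ⟨K, hK⟩
  obtain ⟨n, ⟨h1, h2⟩, hn⟩ := ((hK.and (h (K + 1))).and (Filter.eventually_ge_atTop 1)).exists
  have h3 := (Nat.pow_le_pow_iff_right (by norm_num)).mp (h2.trans h1)
  rw [add_mul] at h3
  omega

/-! ### The unavoidable classes are pairwise incomparable -/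

/-- The `2 × 2` submatrices that do not occur in the given pattern; `a`, `b`, `c` are the entries
in the upper left, the lower left, and the upper right corner. -/
def Pattern.Forbidden (s : Pattern) (a b c : Prop) : Prop :=
  match s with
  | .eq => a ∧ b
  | .ne => ¬ a ∧ ¬ b
  | .leL => ¬ a ∧ b
  | .geL => a ∧ ¬ b
  | .leR => ¬ a ∧ c
  | .geR => a ∧ ¬ c

instance (s : Pattern) (a b c : Prop) [Decidable a] [Decidable b] [Decidable c] :
    Decidable (s.Forbidden a b c) :=
  match s with
  | .eq => inferInstanceAs (Decidable (a ∧ b))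
  | .ne => inferInstanceAs (Decidable (¬ a ∧ ¬ b))
  | .leL => inferInstanceAs (Decidable (¬ a ∧ b))
  | .geL => inferInstanceAs (Decidable (a ∧ ¬ b))
  | .leR => inferInstanceAs (Decidable (¬ a ∧ c))
  | .geR => inferInstanceAs (Decidable (a ∧ ¬ c))

instance {n : ℕ} (s : Pattern) (σ : Equiv.Perm (Fin n)) (i j : Fin n) :
    Decidable (s.cross σ i j) :=
  match s with
  | .eq => inferInstanceAs (Decidable (σ i = j))
  | .ne => inferInstanceAs (Decidable (σ i ≠ j))
  | .leL => inferInstanceAs (Decidable (i ≤ σ.symm j))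
  | .geL => inferInstanceAs (Decidable (i ≥ σ.symm j))
  | .leR => inferInstanceAs (Decidable (j ≤ σ i))
  | .geR => inferInstanceAs (Decidable (j ≥ σ i))

theorem Pattern.not_forbidden_cross {n : ℕ} (s : Pattern) (σ : Equiv.Perm (Fin n))
    {i i' j j' : Fin n} (hi : i < i') (hj : j < j') :
    ¬ s.Forbidden (s.cross σ i j) (s.cross σ i' j) (s.cross σ i j') := by
  cases s with
  | eq => exact fun h => hi.ne (σ.injective (h.1.trans h.2.symm))
  | ne => exact fun h => hi.ne (σ.injective ((not_not.mp h.1).trans (not_not.mp h.2).symm))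
  | leL => exact fun h => h.1 (hi.le.trans h.2)
  | geL => exact fun h => h.2 (h.1.trans hi.le)
  | leR => exact fun h => h.1 (hj.le.trans h.2)
  | geR => exact fun h => h.2 (h.1.trans hj.le)

/-- A permutation whose patterns are recognizable. -/
def testPerm : Equiv.Perm (Fin 5) := Equiv.swap 1 2

theorem testPerm_row (s : Pattern) :
    ∃ j j', s.cross testPerm 3 j ∧ ¬ s.cross testPerm 3 j' := by
  revert s; decide

theorem testPerm_col (s : Pattern) :
    ∃ i i', s.cross testPerm i 1 ∧ ¬ s.cross testPerm i' 1 := by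
  revert s; decide

/-- The bounds `i' ≤ 3` and `1 ≤ j` keep the submatrix within rows and columns whose side is forced
in any division, by the non-constant row 3 and column 1. -/
theorem testPerm_forbidden (s t : Pattern) (h : s ≠ t) : ∃ i i' j j' : Fin 5,
    i < i' ∧ i' ≤ 3 ∧ 1 ≤ j ∧ j < j' ∧ t.Forbidden (s.cross testPerm i j)
      (s.cross testPerm i' j) (s.cross testPerm i j') := by
  revert s t; decide

/-- A class containing `matchingClass s lam rho` contains the test graph. -/
theorem exists_test_graph {C : OrderedGraphClass} {s : Pattern} {lam rho : Bool}
    (h : matchingClass s lam rho ≤ C) : ∃ (e : Fin 5 ⊕ₗ Fin 5 ≃o Fin 10), ∃ H ∈ C 10,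
      ∀ x y, H.Adj (e x) (e y) ↔ (matchingGraph s lam rho testPerm).Adj x y := by
  have hcard : Fintype.card (Fin 5 ⊕ₗ Fin 5) = 10 := by
    rw [Fintype.card_lex, Fintype.card_sum, Fintype.card_fin]
  let e := Fintype.orderIsoFinOfCardEq (Fin 5 ⊕ₗ Fin 5) hcard
  refine ⟨e.symm, _, h 10 ⟨5, testPerm, e.toOrderEmbedding, rfl⟩, fun x y => ?_⟩
  simp

/-- Along increasing triples, both inversions and non-inversions are transitive. -/
theorem permClass_trans {m : ℕ} {H : SimpleGraph (Fin m)} (hH : H ∈ permClass m) {i j k : Fin m}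
    (hij : i < j) (hjk : j < k) :
    (H.Adj i j → H.Adj j k → H.Adj i k) ∧ (¬ H.Adj i j → ¬ H.Adj j k → ¬ H.Adj i k) := by
  obtain ⟨π, rfl⟩ := hH
  simp only [permGraph, hij, hjk, hij.trans hjk, hij.not_gt, hjk.not_gt, (hij.trans hjk).not_gt,
    true_and, false_and, or_false, not_lt]
  exact ⟨fun h1 h2 => h2.trans h1, fun h1 h2 => h1.trans h2⟩

/-- A forbidden submatrix of `leL` or `geL` (two left vertices, one right) or of `leR` or `geR` (one
left, two right), whichever fits the value of `lam` or `rho`, breaks transitivity of edges or of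
non-edges. The left kind is available unless `s` is itself `leL` or `geL`, and then the right kind
is. -/
theorem not_matchingClass_le_permClass (s : Pattern) (lam rho : Bool) :
    ¬ matchingClass s lam rho ≤ permClass := by
  intro hle
  obtain ⟨e, H, hH, hadj⟩ := exists_test_graph hle
  have hLR : ∀ i j : Fin 5, e (toLex (.inl i)) < e (toLex (.inr j)) := fun i j => by simp
  have hLL : ∀ i j : Fin 5, i < j → e (toLex (.inl i)) < e (toLex (.inl j)) :=
    fun i j h => by simpa using h
  have hRR : ∀ i j : Fin 5, i < j → e (toLex (.inr i)) < e (toLex (.inr j)) :=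
    fun i j h => by simpa using h
  have aLL : ∀ i j : Fin 5, H.Adj (e (toLex (.inl i))) (e (toLex (.inl j))) ↔ i ≠ j ∧ lam = true :=
    fun i j => hadj _ _
  have aRR : ∀ i j : Fin 5, H.Adj (e (toLex (.inr i))) (e (toLex (.inr j))) ↔ i ≠ j ∧ rho = true :=
    fun i j => hadj _ _
  have aLR : ∀ i j : Fin 5, H.Adj (e (toLex (.inl i))) (e (toLex (.inr j))) ↔
      s.cross testPerm i j := fun i j => hadj _ _
  by_cases hs : s = .leL ∨ s = .geL
  · have h1 : s ≠ .leR := by rcases hs with rfl | rfl <;> decide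
    have h2 : s ≠ .geR := by rcases hs with rfl | rfl <;> decide
    cases rho with
    | false =>
      obtain ⟨i, -, j, j', -, -, -, hj, hf1, hf2⟩ := testPerm_forbidden s .leR h1
      have := (permClass_trans hH (hLR i j) (hRR j j' hj)).2
      rw [aLR, aRR, aLR] at this
      exact this hf1 (by simp) hf2
    | true =>
      obtain ⟨i, -, j, j', -, -, -, hj, hf1, hf2⟩ := testPerm_forbidden s .geR h2
      have := (permClass_trans hH (hLR i j) (hRR j j' hj)).1
      rw [aLR, aRR, aLR] at this
      exact hf2 (this hf1 ⟨hj.ne, rfl⟩)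
  · rw [not_or] at hs
    cases lam with
    | false =>
      obtain ⟨i, i', j, -, hi, -, -, -, hf1, hf2⟩ := testPerm_forbidden s .geL hs.2
      have := (permClass_trans hH (hLL i i' hi) (hLR i' j)).2
      rw [aLL, aLR, aLR] at this
      exact this (by simp) hf2 hf1
    | true =>
      obtain ⟨i, i', j, -, hi, -, -, -, hf1, hf2⟩ := testPerm_forbidden s .leL hs.1
      have := (permClass_trans hH (hLL i i' hi) (hLR i' j)).1
      rw [aLL, aLR, aLR] at this
      exact hf1 (this ⟨hi.ne, rfl⟩ hf2)

/-- A member of `matchingClass s lam rho` is divided into a left and a right part. -/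
theorem exists_division {s : Pattern} {lam rho : Bool} {m : ℕ} {H : SimpleGraph (Fin m)}
    (hH : H ∈ matchingClass s lam rho m) : ∃ left : Fin m → Prop,
      (∀ u v, u < v → left v → left u) ∧
      (∀ u v, u < v → left v → (H.Adj u v ↔ lam = true)) ∧
      (∀ u v, u < v → ¬ left u → (H.Adj u v ↔ rho = true)) ∧
      ∀ u u' v v', u < u' → left u' → ¬ left v → v < v' →
        ¬ s.Forbidden (H.Adj u v) (H.Adj u' v) (H.Adj u v') := by
  obtain ⟨n, σ, f, rfl⟩ := hH
  have key : ∀ u, (∃ i, f u = toLex (.inl i)) ∨ ∃ j, f u = toLex (.inr j) := by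
    intro u
    rcases h : ofLex (f u) with i | j
    · exact Or.inl ⟨i, h⟩
    · exact Or.inr ⟨j, h⟩
  have hnot : ∀ u, (¬ ∃ i, f u = toLex (.inl i)) → ∃ j, f u = toLex (.inr j) :=
    fun u h => (key u).resolve_left h
  have hleft : ∀ u v, u < v → (∃ i, f v = toLex (.inl i)) → ∃ i, f u = toLex (.inl i) := by
    rintro u v huv ⟨i, hi⟩
    have hlt := f.strictMono huv
    rcases key u with h | ⟨j, hj⟩
    · exact h
    · rw [hi, hj] at hlt
      simp at hlt
  have hright : ∀ u v, u < v → (¬ ∃ i, f u = toLex (.inl i)) → ¬ ∃ i, f v = toLex (.inl i) :=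
    fun u v huv h h' => h (hleft u v huv h')
  refine ⟨fun u => ∃ i, f u = toLex (.inl i), hleft, ?_, ?_, ?_⟩
  · intro u v huv hv
    obtain ⟨i, hi⟩ := hleft u v huv hv
    obtain ⟨j, hj⟩ := hv
    have hne : i ≠ j := by
      rintro rfl
      exact huv.ne (f.injective (hi.trans hj.symm))
    rw [SimpleGraph.comap_adj, hi, hj]
    exact ⟨fun h => h.2, fun h => ⟨hne, h⟩⟩
  · intro u v huv hu
    obtain ⟨i, hi⟩ := hnot u hu
    obtain ⟨j, hj⟩ := hnot v (hright u v huv hu)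
    have hne : i ≠ j := by
      rintro rfl
      exact huv.ne (f.injective (hi.trans hj.symm))
    rw [SimpleGraph.comap_adj, hi, hj]
    exact ⟨fun h => h.2, fun h => ⟨hne, h⟩⟩
  · intro u u' v v' huu' hu' hv hvv'
    obtain ⟨i, hi⟩ := hleft u u' huu' hu'
    obtain ⟨i', hi'⟩ := hu'
    obtain ⟨j', hj'⟩ := hnot v' (hright v v' hvv' hv)
    obtain ⟨j, hj⟩ := hnot v hv
    have h1 : i < i' := by
      have := f.strictMono huu'
      rw [hi, hi'] at this
      simpa using this
    have h2 : j < j' := by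
      have := f.strictMono hvv'
      rw [hj, hj'] at this
      simpa using this
    rw [SimpleGraph.comap_adj, SimpleGraph.comap_adj, SimpleGraph.comap_adj, hi, hi', hj, hj']
    exact s.not_forbidden_cross σ h1 h2

/-- The permutation has the values 0, 2, 1, 3, 5, 4. Any division leaves the vertices 0, 1, 2 on the
left or 3, 4, 5 on the right, and each triple has both an edge and a non-edge. -/
theorem not_permClass_le_matchingClass (s : Pattern) (lam rho : Bool) :
    ¬ permClass ≤ matchingClass s lam rho := by
  intro hle
  let π : Equiv.Perm (Fin 6) := Equiv.swap 1 2 * Equiv.swap 4 5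
  obtain ⟨left, hd, hl, hr, -⟩ := exists_division (hle 6 ⟨π, rfl⟩)
  have h01 : ¬ (permGraph π).Adj 0 1 := by
    simp only [permGraph]; decide
  have h12 : (permGraph π).Adj 1 2 := by
    simp only [permGraph]; decide
  have h34 : ¬ (permGraph π).Adj 3 4 := by
    simp only [permGraph]; decide
  have h45 : (permGraph π).Adj 4 5 := by
    simp only [permGraph]; decide
  by_cases h2 : left 2
  · exact h01 ((hl 0 1 (by decide) (hd 1 2 (by decide) h2)).mpr
      ((hl 1 2 (by decide) h2).mp h12))
  · have h3 : ¬ left 3 := fun h => h2 (hd 2 3 (by decide) h)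
    have h4 : ¬ left 4 := fun h => h3 (hd 3 4 (by decide) h)
    exact h34 ((hr 3 4 (by decide) h3).mpr ((hr 4 5 (by decide) h4).mp h45))

/-- An unknown division of the test graph must put left vertex 3 on the left and right vertex 1 on
the right, since otherwise row 3 or column 1 would be constant. Hence the left vertices up to 3 and
the right vertices from 1 on are placed correctly, which forces `lam = lam'` and `rho = rho'`, and
the forbidden submatrix excludes `s ≠ s'`. -/
theorem not_matchingClass_le_matchingClass {s s' : Pattern} {lam lam' rho rho' : Bool}
    (hne : (s, lam, rho) ≠ (s', lam', rho')) :
    ¬ matchingClass s lam rho ≤ matchingClass s' lam' rho' := by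
  intro hle
  obtain ⟨e, H, hH, hadj⟩ := exists_test_graph hle
  obtain ⟨left, hd, hl, hr, hforb⟩ := exists_division hH
  have hLR : ∀ i j : Fin 5, e (toLex (.inl i)) < e (toLex (.inr j)) := fun i j => by simp
  have hLL : ∀ i j : Fin 5, i < j → e (toLex (.inl i)) < e (toLex (.inl j)) :=
    fun i j h => by simpa using h
  have hRR : ∀ i j : Fin 5, i < j → e (toLex (.inr i)) < e (toLex (.inr j)) :=
    fun i j h => by simpa using h
  have aLL : ∀ i j : Fin 5, H.Adj (e (toLex (.inl i))) (e (toLex (.inl j))) ↔ i ≠ j ∧ lam = true :=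
    fun i j => hadj _ _
  have aRR : ∀ i j : Fin 5, H.Adj (e (toLex (.inr i))) (e (toLex (.inr j))) ↔ i ≠ j ∧ rho = true :=
    fun i j => hadj _ _
  have aLR : ∀ i j : Fin 5, H.Adj (e (toLex (.inl i))) (e (toLex (.inr j))) ↔
      s.cross testPerm i j := fun i j => hadj _ _
  have h3 : left (e (toLex (.inl 3))) := by
    by_contra hcon
    obtain ⟨j, j', hj, hj'⟩ := testPerm_row s
    rw [← aLR] at hj hj'
    exact hj' ((hr _ _ (hLR 3 j') hcon).mpr ((hr _ _ (hLR 3 j) hcon).mp hj))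
  have h1 : ¬ left (e (toLex (.inr 1))) := by
    intro hcon
    obtain ⟨i, i', hi, hi'⟩ := testPerm_col s
    rw [← aLR] at hi hi'
    exact hi' ((hl _ _ (hLR i' 1) hcon).mpr ((hl _ _ (hLR i 1) hcon).mp hi))
  have hlam : lam = lam' := by
    have := hl _ _ (hLL 2 3 (by decide)) h3
    rw [aLL] at this
    rw [Bool.eq_iff_iff, ← this]
    simp
  have hrho : rho = rho' := by
    have := hr _ _ (hRR 1 2 (by decide)) h1
    rw [aRR] at this
    rw [Bool.eq_iff_iff, ← this]
    simp
  have hs : s ≠ s' := by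
    rintro rfl
    exact hne (by rw [hlam, hrho])
  obtain ⟨i, i', j, j', hi, hi3, hj1, hj, hf⟩ := testPerm_forbidden s s' hs
  have hli' : left (e (toLex (.inl i'))) := by
    rcases hi3.lt_or_eq with h | rfl
    · exact hd _ _ (hLL _ _ h) h3
    · exact h3
  have hrj : ¬ left (e (toLex (.inr j))) := by
    rcases hj1.lt_or_eq with h | rfl
    · exact fun h' => h1 (hd _ _ (hRR _ _ h) h')
    · exact h1
  refine hforb _ _ _ _ (hLL i i' hi) hli' hrj (hRR j j' hj) ?_
  rwa [aLR, aLR, aLR]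

theorem not_unavoidable_le : ∀ {c d : Option (Pattern × Bool × Bool)}, c ≠ d →
    ¬ unavoidable c ≤ unavoidable d
  | none, none, h => absurd rfl h
  | none, some (_, _, _), _ => not_permClass_le_matchingClass _ _ _
  | some (_, _, _), none, _ => not_matchingClass_le_permClass _ _ _
  | some (_, _, _), some (_, _, _), h =>
    not_matchingClass_le_matchingClass fun h' => h (congrArg some h')

/-! ### The main theorem -/

theorem isStanleyWilf_unavoidable (c : Option (Pattern × Bool × Bool)) :
    (unavoidable c).IsStanleyWilf := by
  refine ⟨isHereditary_unavoidable c, hasSuperexpGrowth_unavoidable c, fun D hD hlt => ?_⟩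
  by_contra hexp
  obtain ⟨d, hd⟩ := exists_unavoidable_le_of_not_hasExpGrowth hD hexp
  by_cases hdc : d = c
  · subst hdc
    exact absurd hd hlt.not_ge
  · exact not_unavoidable_le hdc (hd.trans hlt.le)

theorem isStanleyWilf_iff {C : OrderedGraphClass} :
    C.IsStanleyWilf ↔ C ∈ Set.range unavoidable := by
  constructor
  · rintro ⟨hC, hsup, hmin⟩
    obtain ⟨c, hc⟩ := exists_unavoidable_le_of_not_hasExpGrowth hC hsup.not_hasExpGrowth
    refine ⟨c, ?_⟩
    by_contra hne
    exact (hasSuperexpGrowth_unavoidable c).not_hasExpGrowth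
      (hmin _ (isHereditary_unavoidable c) (lt_of_le_of_ne hc hne))
  · rintro ⟨c, rfl⟩
    exact isStanleyWilf_unavoidable c

theorem unavoidable_injective : Function.Injective unavoidable := by
  intro c d h
  by_contra hne
  exact not_unavoidable_le hne h.le

end OrderedGraphClass

theorem corollary7p9 :
    (∀ C : OrderedGraphClass, C.IsStanleyWilf ↔
      (C = OrderedGraphClass.permClass ∨
        ∃ (s : OrderedGraphClass.Pattern) (lam rho : Bool),
          C = OrderedGraphClass.matchingClass s lam rho)) ∧
    {C : OrderedGraphClass | C.IsStanleyWilf}.ncard = 25 ∧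
    (∀ (s : OrderedGraphClass.Pattern) (lam rho : Bool),
      ¬ OrderedGraphClass.permClass ≤ OrderedGraphClass.matchingClass s lam rho ∧
      ¬ OrderedGraphClass.matchingClass s lam rho ≤ OrderedGraphClass.permClass) ∧
    (∀ (s s' : OrderedGraphClass.Pattern) (lam lam' rho rho' : Bool),
      (s, lam, rho) ≠ (s', lam', rho') →
        ¬ OrderedGraphClass.matchingClass s lam rho ≤
            OrderedGraphClass.matchingClass s' lam' rho') := by
  open OrderedGraphClass in
  refine ⟨fun C => ?_, ?_, fun s lam rho => ⟨not_permClass_le_matchingClass s lam rho,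
    not_matchingClass_le_permClass s lam rho⟩,
    fun s s' lam lam' rho rho' h => not_matchingClass_le_matchingClass h⟩
  · rw [isStanleyWilf_iff]
    constructor
    · rintro ⟨_ | ⟨s, lam, rho⟩, rfl⟩
      · exact Or.inl rfl
      · exact Or.inr ⟨s, lam, rho, rfl⟩
    · rintro (rfl | ⟨s, lam, rho, rfl⟩)
      · exact ⟨none, rfl⟩
      · exact ⟨some (s, lam, rho), rfl⟩
  · have : {C : OrderedGraphClass | C.IsStanleyWilf} = Set.range unavoidable :=
      Set.ext fun C => isStanleyWilf_iff
    rw [this, ← Set.image_univ, Set.ncard_image_of_injective _ unavoidable_injective,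
      Set.ncard_univ, Nat.card_eq_fintype_card]
    rfl
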